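/- **Problem.** There are $n\ge 1$ non-preemptive jobs to be processed on a single machine that handles at most one job at a time. All jobs have the same processing time $p>0$; job $j$ has a release date $r_j\ge 0$ and a non-increasing utility function $u_j:[0,\infty)\to\mathbb{R}$ of its completion time. All data are real, and no continuity or linearity of the $u_j$ is assumed. A schedule $\sigma$ assigns to each job a starting time $s_j$; it is feasible if $s_j\ge r_j$ for all $j$ and no two jobs overlap, i.e. $s_i+p\le s_j$ or $s_j+p\le s_i$ for all $i\ne j$. It is semi-active if no job can start earlier, the others being unchanged, without violating feasibility or the given order of the jobs. Idle times are allowed. Let $\mathcal{S}$ be the set of feasible semi-active schedules, let $C_j(\sigma)=s_j+p$ be the completion time of job $j$, and let $u_{\min}(\sigma)=\min_j u_j(C_j(\sigma))$. The fair problem $1|p_j=p,r_j,u_j|u_{\min}$ asks for a fair schedule, that is, some $\sigma_F\in\mathcal{S}$ with $u_{\min}(\sigma_F)=\max_{\sigma\in\mathcal{S}}u_{\min}(\sigma)=:u_F$. **Model of computation.** A random access machine with registers and arrays for natural numbers and for real numbers, with addition, subtraction, halving (rounded down for naturals) and comparison at unit cost, and in which a utility value $u_j(t)$ can be computed in constant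 time. (There is no multiplication, general division or rounding of real numbers.) The input consists of $n$, $p$, $r_1,\dots,r_n$, two numbers $LB$ and $UB$ with $LB\le u_F\le UB$, and access to the utility functions through their values. **Theorem.** The problem $1|p_j=p,r_j,u_j|u_{\min}$ can be solved exactly in polynomial time $O(n^3\log n\,\log(UB-LB))$, where $UB$ and $LB$ are an upper and a lower bound on the optimal objective value $u_F$. Precisely: there are one program for this machine and one constant $c$ such that, for every $n\ge1$, every instance with $n$ jobs, and all $LB\le u_F\le UB$, the program halts with a fair schedule after at most $$c\, n^3\,\log(n+1)\,\log(UB-LB+2)$$ elementary operations. -/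

import Mathlib

namespace FairScheduling

/-! ### The scheduling problem `1 | p_j = p, r_j, u_j | u_min` -/

/-- `n` non-preemptive jobs on a single machine, with a common processing time `p`, release dates
`r j` and utility functions `u j` that are non-increasing in the completion time. -/
structure Problem (n : ℕ) where
  p : ℝ
  r : Fin n → ℝ
  u : Fin n → ℝ → ℝ
  p_pos : 0 < p
  r_nonneg : ∀ j, 0 ≤ r j
  u_antitone : ∀ j, AntitoneOn (u j) (Set.Ici 0)

namespace Problem

variable {n : ℕ}

/-- The starting times `s` describe a feasible schedule: no job starts before its release date, and
no two jobs overlap. -/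
def Feasible (I : Problem n) (s : Fin n → ℝ) : Prop :=
  (∀ j, I.r j ≤ s j) ∧ ∀ i j, i ≠ j → s i + I.p ≤ s j ∨ s j + I.p ≤ s i

/-- The two schedules process the jobs in the same order. -/
def SameOrder (s s' : Fin n → ℝ) : Prop :=
  ∀ i j, s i < s j ↔ s' i < s' j

/-- No job can start earlier, the others being unchanged, without violating feasibility or the given
order. -/
def SemiActive (I : Problem n) (s : Fin n → ℝ) : Prop :=
  ∀ j, ∀ t < s j,
    ¬ (I.Feasible (Function.update s j t) ∧ SameOrder s (Function.update s j t))

/-- The set of feasible semi-active schedules. -/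
def schedules (I : Problem n) : Set (Fin n → ℝ) :=
  {s | I.Feasible s ∧ I.SemiActive s}

/-- The minimum utility in the schedule `s`; the completion time of job `j` is `s j + p`. -/
noncomputable def uMin (I : Problem n) (s : Fin n → ℝ) : ℝ :=
  ⨅ j, I.u j (s j + I.p)

/-- `s` is a fair schedule: it maximizes the minimum utility. -/
def IsFair (I : Problem n) (s : Fin n → ℝ) : Prop :=
  s ∈ I.schedules ∧ ∀ s' ∈ I.schedules, I.uMin s' ≤ I.uMin s

end Problem

/-! ### Random access machine programs with a step count

A program works on natural number registers, real registers, arrays of naturals and arrays of reals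
(registers, arrays and array cells are numbered by naturals). The arithmetic is addition,
subtraction and halving only. The utility functions are accessed only through their values. -/

/-- Expressions for natural numbers (used as indices and counters). -/
inductive NatExpr where
  | const (k : ℕ)
  | reg (x : ℕ)
  | cell (a : ℕ) (i : NatExpr)
  | add (e f : NatExpr)
  | sub (e f : NatExpr)
  | half (e : NatExpr)

/-- Expressions for real numbers; `util j t` asks for the utility of job `j` completing at `t`. -/
inductive RealExpr where
  | const (k : ℤ)
  | reg (x : ℕ)
  | cell (a : ℕ) (i : NatExpr)
  | add (e f : RealExpr)
  | sub (e f : RealExpr)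
  | half (e : RealExpr)
  | util (j : NatExpr) (t : RealExpr)

/-- Tests. -/
inductive BoolExpr where
  | natLe (e f : NatExpr)
  | realLe (e f : RealExpr)
  | not (b : BoolExpr)
  | and (b c : BoolExpr)

/-- Programs. -/
inductive Program where
  | skip
  | setNat (x : ℕ) (e : NatExpr)
  | setReal (x : ℕ) (e : RealExpr)
  | storeNat (a : ℕ) (i e : NatExpr)
  | storeReal (a : ℕ) (i : NatExpr) (e : RealExpr)
  | seq (P Q : Program)
  | ite (b : BoolExpr) (P Q : Program)
  | while (b : BoolExpr) (P : Program)

/-- The memory. -/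
structure State where
  nat : ℕ → ℕ
  real : ℕ → ℝ
  natArr : ℕ → ℕ → ℕ
  realArr : ℕ → ℕ → ℝ

/-- Value of an expression. -/
def NatExpr.eval (σ : State) : NatExpr → ℕ
  | const k => k
  | reg x => σ.nat x
  | cell a i => σ.natArr a (i.eval σ)
  | add e f => e.eval σ + f.eval σ
  | sub e f => e.eval σ - f.eval σ
  | half e => e.eval σ / 2

/-- Number of elementary operations needed to evaluate an expression. -/
def NatExpr.cost : NatExpr → ℕ
  | const _ => 1
  | reg _ => 1
  | cell _ i => i.cost + 1
  | add e f => e.cost + f.cost + 1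
  | sub e f => e.cost + f.cost + 1
  | half e => e.cost + 1

/-- Value of an expression, when `u j t` is the utility of job `j` completing at time `t`. -/
noncomputable def RealExpr.eval (u : ℕ → ℝ → ℝ) (σ : State) : RealExpr → ℝ
  | const k => k
  | reg x => σ.real x
  | cell a i => σ.realArr a (i.eval σ)
  | add e f => e.eval u σ + f.eval u σ
  | sub e f => e.eval u σ - f.eval u σ
  | half e => e.eval u σ / 2
  | util j t => u (j.eval σ) (t.eval u σ)

/-- Number of elementary operations needed to evaluate an expression; a utility function is evaluated
in constant time. -/
def RealExpr.cost : RealExpr → ℕ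
  | const _ => 1
  | reg _ => 1
  | cell _ i => i.cost + 1
  | add e f => e.cost + f.cost + 1
  | sub e f => e.cost + f.cost + 1
  | half e => e.cost + 1
  | util j t => j.cost + t.cost + 1

/-- Truth of a test. -/
def BoolExpr.Holds (u : ℕ → ℝ → ℝ) (σ : State) : BoolExpr → Prop
  | natLe e f => e.eval σ ≤ f.eval σ
  | realLe e f => e.eval u σ ≤ f.eval u σ
  | not b => ¬ b.Holds u σ
  | and b c => b.Holds u σ ∧ c.Holds u σ

/-- Number of elementary operations needed to evaluate a test. -/
def BoolExpr.cost : BoolExpr → ℕ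
  | natLe e f => e.cost + f.cost + 1
  | realLe e f => e.cost + f.cost + 1
  | not b => b.cost + 1
  | and b c => b.cost + c.cost + 1

/-- `Exec u P σ T σ'`: with utilities `u`, the program `P` started in the state `σ` halts in the
state `σ'` after exactly `T` elementary operations. -/
inductive Exec (u : ℕ → ℝ → ℝ) : Program → State → ℕ → State → Prop where
  | skip (σ : State) : Exec u Program.skip σ 1 σ
  | setNat (x : ℕ) (e : NatExpr) (σ : State) :
      Exec u (Program.setNat x e) σ (e.cost + 1)
        { σ with nat := Function.update σ.nat x (e.eval σ) }
  | setReal (x : ℕ) (e : RealExpr) (σ : State) :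
      Exec u (Program.setReal x e) σ (e.cost + 1)
        { σ with real := Function.update σ.real x (e.eval u σ) }
  | storeNat (a : ℕ) (i e : NatExpr) (σ : State) :
      Exec u (Program.storeNat a i e) σ (i.cost + e.cost + 1)
        { σ with natArr :=
            Function.update σ.natArr a (Function.update (σ.natArr a) (i.eval σ) (e.eval σ)) }
  | storeReal (a : ℕ) (i : NatExpr) (e : RealExpr) (σ : State) :
      Exec u (Program.storeReal a i e) σ (i.cost + e.cost + 1)
        { σ with realArr :=
            Function.update σ.realArr a (Function.update (σ.realArr a) (i.eval σ) (e.eval u σ)) }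
  | seq {P Q : Program} {σ₁ σ₂ σ₃ : State} {T₁ T₂ : ℕ} :
      Exec u P σ₁ T₁ σ₂ → Exec u Q σ₂ T₂ σ₃ → Exec u (Program.seq P Q) σ₁ (T₁ + T₂) σ₃
  | iteTrue {b : BoolExpr} {P Q : Program} {σ σ' : State} {T : ℕ} :
      b.Holds u σ → Exec u P σ T σ' → Exec u (Program.ite b P Q) σ (b.cost + T) σ'
  | iteFalse {b : BoolExpr} {P Q : Program} {σ σ' : State} {T : ℕ} :
      ¬ b.Holds u σ → Exec u Q σ T σ' → Exec u (Program.ite b P Q) σ (b.cost + T) σ'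
  | whileTrue {b : BoolExpr} {P : Program} {σ₁ σ₂ σ₃ : State} {T₁ T₂ : ℕ} :
      b.Holds u σ₁ → Exec u P σ₁ T₁ σ₂ → Exec u (Program.while b P) σ₂ T₂ σ₃ →
        Exec u (Program.while b P) σ₁ (b.cost + T₁ + T₂) σ₃
  | whileFalse {b : BoolExpr} {P : Program} {σ : State} :
      ¬ b.Holds u σ → Exec u (Program.while b P) σ b.cost σ

namespace Problem

/-- The utility functions as they are available to a program: indexed by naturals, with value `0`
where there is no job. -/
noncomputable def utility {n : ℕ} (I : Problem n) (j : ℕ) (t : ℝ) : ℝ :=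
  if h : j < n then I.u ⟨j, h⟩ t else 0

/-- The initial memory: `n` in natural register `0`; `p`, `LB`, `UB` in the real registers `0`, `1`,
`2`; the release dates in real array `0`; zeros elsewhere. -/
noncomputable def input {n : ℕ} (I : Problem n) (LB UB : ℝ) : State where
  nat := fun x => if x = 0 then n else 0
  real := fun x => if x = 0 then I.p else if x = 1 then LB else if x = 2 then UB else 0
  natArr := fun _ _ => 0
  realArr := fun a i => if a = 0 then (if h : i < n then I.r ⟨i, h⟩ else 0) else 0

end Problem

/-- The starting times of `n` jobs, returned in real array `1`. -/
def State.output (n : ℕ) (σ : State) : Fin n → ℝ :=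
  fun j => σ.realArr 1 j

end FairScheduling

/-!
The bounds `LB` and `UB` are not needed: a fair schedule is found after `O(n ^ 3 log n)` elementary
operations, and `log (UB - LB + 2)` is at least `log 2`.

In a semi-active schedule every job starts at its release date or directly after another job, so all
starting times lie in the grid `r i + k p` with `i, k < n` (`Problem.exists_start_eq`). Hence the
minimum utility of a schedule is one of the `n ^ 3` values `u j (r i + k p + p)`. The program lists
these values, sorts them by merge sort (`runs_mergeSort`) and finds the largest attainable one by
binary search (`runs_searchProgram`). There are `O(log n)` tests "is there a schedule with minimum
utility at least `v`?", so it is enough that each takes `O(n ^ 3)` operations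
(`runs_decideProgram`).

Such a test is a feasibility problem with release dates and deadlines, as each `u j` is
non-increasing: job `j` may start up to the last grid time at which its utility is still `v`. For
equal processing times this problem is solved by the forbidden regions of Garey, Johnson, Simons and
Tarjan. The jobs are taken by non-increasing release dates. For each job `q` and each deadline `d`,
the jobs released not before `q` and due by `d` are packed backwards from `d`. If the packing starts
at `c`, no job can start strictly between `c - p` and the release date of `q` if the deadlines are met
(`IsForbidden.allowed`). Afterwards the jobs are scheduled greedily forwards, earliest deadline first,
outside the forbidden regions. If this schedule missed a deadline, then the backward packing from
that deadline would start before the busy stretch of the greedy schedule that leads to the miss. So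
the greedy rule could have started this stretch earlier, unless the job in front of it started in a
forbidden region; both are impossible (`IsGreedy.le_deadline`). Finally the greedy order is
executed with every job as early as possible, which delays no job and gives a semi-active schedule
(`IsGreedy.freeTime_le`, `Problem.mem_schedules_of_order`).

The programs are verified in a total-correctness logic: `Runs u P σ T Q` says that `P`, started in
`σ`, halts within `T` operations in a memory satisfying `Q`. The memory is used as follows.

* Natural registers: `0` is `n`; `1`, `2`, `3` are loop counters; `4` is the number of candidate
  values; `5` is a rank or the length of the sorted segments; `6` to `11` are positions in the merge
  sort; `12` to `14` are positions in the binary search; `15` is the result of the test; `16` is the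
  current job.
* Real registers: `0` is `p`; `3` is the current time; `4` is the value `v` that is tested.
* Natural arrays: `0` is the list of jobs by non-increasing release dates; `1` marks the scheduled
  jobs; `2` is the greedy order. In the arrays from `natArr 1` on, jobs are given by their positions
  in the list.
* Real arrays: `0` are the release dates; `1` is the schedule returned; `2` are the candidate values,
  and `3` is the auxiliary array for sorting them. By position in the list, `4` are the release
  dates, `5` the deadlines, `6` the backward packings and `7` the left ends of the forbidden regions.
  In the greedy order, `8` are the starting times.
-/

namespace FairScheduling

/-! ### Reasoning about programs: memory updates, frames and running times -/

namespace State

/-- The memory `σ` with the natural register `x` set to `v`. -/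
def setNat (σ : State) (x v : ℕ) : State :=
  { σ with nat := Function.update σ.nat x v }

/-- The memory `σ` with the real register `x` set to `v`. -/
def setReal (σ : State) (x : ℕ) (v : ℝ) : State :=
  { σ with real := Function.update σ.real x v }

/-- The memory `σ` with cell `i` of the natural array `a` set to `v`. -/
def storeNat (σ : State) (a i v : ℕ) : State :=
  { σ with natArr := Function.update σ.natArr a (Function.update (σ.natArr a) i v) }

/-- The memory `σ` with cell `i` of the real array `a` set to `v`. -/
def storeReal (σ : State) (a i : ℕ) (v : ℝ) : State :=
  { σ with realArr := Function.update σ.realArr a (Function.update (σ.realArr a) i v) }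

variable (σ : State) (x y a b i v : ℕ) (w : ℝ)

@[simp] theorem setNat_nat : (σ.setNat x v).nat y = if y = x then v else σ.nat y := by
  simp [setNat, Function.update_apply]
@[simp] theorem setNat_real : (σ.setNat x v).real = σ.real := rfl
@[simp] theorem setNat_natArr : (σ.setNat x v).natArr = σ.natArr := rfl
@[simp] theorem setNat_realArr : (σ.setNat x v).realArr = σ.realArr := rfl

@[simp] theorem setReal_nat : (σ.setReal x w).nat = σ.nat := rfl
@[simp] theorem setReal_real : (σ.setReal x w).real y = if y = x then w else σ.real y := by
  simp [setReal, Function.update_apply]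
@[simp] theorem setReal_natArr : (σ.setReal x w).natArr = σ.natArr := rfl
@[simp] theorem setReal_realArr : (σ.setReal x w).realArr = σ.realArr := rfl

@[simp] theorem storeNat_nat : (σ.storeNat a i v).nat = σ.nat := rfl
@[simp] theorem storeNat_real : (σ.storeNat a i v).real = σ.real := rfl
@[simp] theorem storeNat_natArr : (σ.storeNat a i v).natArr b =
    if b = a then Function.update (σ.natArr a) i v else σ.natArr b := by
  simp [storeNat, Function.update_apply]
@[simp] theorem storeNat_realArr : (σ.storeNat a i v).realArr = σ.realArr := rfl

@[simp] theorem storeReal_nat : (σ.storeReal a i w).nat = σ.nat := rfl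
@[simp] theorem storeReal_real : (σ.storeReal a i w).real = σ.real := rfl
@[simp] theorem storeReal_natArr : (σ.storeReal a i w).natArr = σ.natArr := rfl
@[simp] theorem storeReal_realArr : (σ.storeReal a i w).realArr b =
    if b = a then Function.update (σ.realArr a) i w else σ.realArr b := by
  simp [storeReal, Function.update_apply]

end State

namespace Program

/-- Sequential composition. -/
infixr:60 " ;; " => Program.seq

/-- `P` does not assign to the natural register `x`. -/
def keepsNat (x : ℕ) : Program → Bool
  | setNat y _ => y != x
  | seq P Q => P.keepsNat x && Q.keepsNat x
  | ite _ P Q => P.keepsNat x && Q.keepsNat x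
  | .while _ P => P.keepsNat x
  | _ => true

/-- `P` does not assign to the real register `x`. -/
def keepsReal (x : ℕ) : Program → Bool
  | setReal y _ => y != x
  | seq P Q => P.keepsReal x && Q.keepsReal x
  | ite _ P Q => P.keepsReal x && Q.keepsReal x
  | .while _ P => P.keepsReal x
  | _ => true

/-- `P` does not write into the natural array `a`. -/
def keepsNatArr (a : ℕ) : Program → Bool
  | storeNat b _ _ => b != a
  | seq P Q => P.keepsNatArr a && Q.keepsNatArr a
  | ite _ P Q => P.keepsNatArr a && Q.keepsNatArr a
  | .while _ P => P.keepsNatArr a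
  | _ => true

/-- `P` does not write into the real array `a`. -/
def keepsRealArr (a : ℕ) : Program → Bool
  | storeReal b _ _ => b != a
  | seq P Q => P.keepsRealArr a && Q.keepsRealArr a
  | ite _ P Q => P.keepsRealArr a && Q.keepsRealArr a
  | .while _ P => P.keepsRealArr a
  | _ => true

/-- `for x = 0, …, y - 1 do P`, where the registers `x` and `y` are left alone by `P`. -/
def forLoop (x y : ℕ) (P : Program) : Program :=
  setNat x (.const 0) ;;
  .while (.not (.natLe (.reg y) (.reg x))) (P ;; setNat x (.add (.reg x) (.const 1)))

end Program

open Program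

/-- The memories `σ` and `σ'` agree on everything to which `P` has no assignment. -/
structure Frame (P : Program) (σ σ' : State) : Prop where
  nat : ∀ x, P.keepsNat x = true → σ'.nat x = σ.nat x
  real : ∀ x, P.keepsReal x = true → σ'.real x = σ.real x
  natArr : ∀ a, P.keepsNatArr a = true → σ'.natArr a = σ.natArr a
  realArr : ∀ a, P.keepsRealArr a = true → σ'.realArr a = σ.realArr a

theorem Frame.refl (P : Program) (σ : State) : Frame P σ σ :=
  ⟨fun _ _ => rfl, fun _ _ => rfl, fun _ _ => rfl, fun _ _ => rfl⟩

theorem Frame.trans {P : Program} {σ₁ σ₂ σ₃ : State} (h : Frame P σ₁ σ₂) (h' : Frame P σ₂ σ₃) :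
    Frame P σ₁ σ₃ :=
  ⟨fun x hx => (h'.nat x hx).trans (h.nat x hx), fun x hx => (h'.real x hx).trans (h.real x hx),
    fun x hx => (h'.natArr x hx).trans (h.natArr x hx),
    fun x hx => (h'.realArr x hx).trans (h.realArr x hx)⟩

theorem Frame.of_le {P Q : Program} {σ σ' : State} (h : Frame P σ σ')
    (h₁ : ∀ x, Q.keepsNat x = true → P.keepsNat x = true)
    (h₂ : ∀ x, Q.keepsReal x = true → P.keepsReal x = true)
    (h₃ : ∀ x, Q.keepsNatArr x = true → P.keepsNatArr x = true)
    (h₄ : ∀ x, Q.keepsRealArr x = true → P.keepsRealArr x = true) : Frame Q σ σ' :=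
  ⟨fun x hx => h.nat x (h₁ x hx), fun x hx => h.real x (h₂ x hx),
    fun x hx => h.natArr x (h₃ x hx), fun x hx => h.realArr x (h₄ x hx)⟩

/-- An execution changes only what its program assigns to. -/
theorem Exec.frame {u : ℕ → ℝ → ℝ} {P : Program} {σ σ' : State} {T : ℕ} (h : Exec u P σ T σ') :
    Frame P σ σ' := by
  induction h with
  | skip σ => exact Frame.refl _ _
  | setNat x e σ =>
    refine ⟨fun y hy => ?_, fun _ _ => rfl, fun _ _ => rfl, fun _ _ => rfl⟩
    have : x ≠ y := by simpa [keepsNat] using hy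
    simp [this.symm]
  | setReal x e σ =>
    refine ⟨fun _ _ => rfl, fun y hy => ?_, fun _ _ => rfl, fun _ _ => rfl⟩
    have : x ≠ y := by simpa [keepsReal] using hy
    simp [this.symm]
  | storeNat x i e σ =>
    refine ⟨fun _ _ => rfl, fun _ _ => rfl, fun y hy => ?_, fun _ _ => rfl⟩
    have : x ≠ y := by simpa [keepsNatArr] using hy
    simp [this.symm]
  | storeReal x i e σ =>
    refine ⟨fun _ _ => rfl, fun _ _ => rfl, fun _ _ => rfl, fun y hy => ?_⟩
    have : x ≠ y := by simpa [keepsRealArr] using hy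
    simp [this.symm]
  | seq _ _ ih₁ ih₂ =>
    refine (ih₁.of_le ?_ ?_ ?_ ?_).trans (ih₂.of_le ?_ ?_ ?_ ?_) <;>
      simp +contextual [keepsNat, keepsReal, keepsNatArr, keepsRealArr]
  | iteTrue _ _ ih =>
    refine ih.of_le ?_ ?_ ?_ ?_ <;>
      simp +contextual [keepsNat, keepsReal, keepsNatArr, keepsRealArr]
  | iteFalse _ _ ih =>
    refine ih.of_le ?_ ?_ ?_ ?_ <;>
      simp +contextual [keepsNat, keepsReal, keepsNatArr, keepsRealArr]
  | whileTrue _ _ _ ih₁ ih₂ =>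
    refine Frame.trans (ih₁.of_le ?_ ?_ ?_ ?_) ih₂ <;>
      simp [keepsNat, keepsReal, keepsNatArr, keepsRealArr]
  | whileFalse _ => exact Frame.refl _ _

/-- `Runs u P σ T Q`: started in `σ`, the program `P` halts after at most `T` elementary operations
in a memory that satisfies `Q`. -/
def Runs (u : ℕ → ℝ → ℝ) (P : Program) (σ : State) (T : ℕ) (Q : State → Prop) : Prop :=
  ∃ t σ', t ≤ T ∧ Exec u P σ t σ' ∧ Q σ'

theorem BoolExpr.cost_pos (b : BoolExpr) : 0 < b.cost := by
  cases b <;> simp [BoolExpr.cost]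

namespace Runs

variable {u : ℕ → ℝ → ℝ} {P P' : Program} {σ : State} {T T' : ℕ} {Q Q' : State → Prop}

theorem mono (h : Runs u P σ T Q) (hT : T ≤ T') : Runs u P σ T' Q := by
  obtain ⟨t, σ', ht, hex, hq⟩ := h
  exact ⟨t, σ', ht.trans hT, hex, hq⟩

theorem imp (h : Runs u P σ T Q) (hQ : ∀ σ', Frame P σ σ' → Q σ' → Q' σ') : Runs u P σ T Q' := by
  obtain ⟨t, σ', ht, hex, hq⟩ := h
  exact ⟨t, σ', ht, hex, hQ σ' hex.frame hq⟩

theorem skip (h : Q σ) : Runs u .skip σ 1 Q := ⟨1, σ, le_rfl, .skip σ, h⟩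

theorem setNat {x : ℕ} {e : NatExpr} (h : Q (σ.setNat x (e.eval σ))) :
    Runs u (.setNat x e) σ (e.cost + 1) Q := ⟨_, _, le_rfl, .setNat x e σ, h⟩

theorem setReal {x : ℕ} {e : RealExpr} (h : Q (σ.setReal x (e.eval u σ))) :
    Runs u (.setReal x e) σ (e.cost + 1) Q := ⟨_, _, le_rfl, .setReal x e σ, h⟩

theorem storeNat {a : ℕ} {i e : NatExpr} (h : Q (σ.storeNat a (i.eval σ) (e.eval σ))) :
    Runs u (.storeNat a i e) σ (i.cost + e.cost + 1) Q := ⟨_, _, le_rfl, .storeNat a i e σ, h⟩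

theorem storeReal {a : ℕ} {i : NatExpr} {e : RealExpr}
    (h : Q (σ.storeReal a (i.eval σ) (e.eval u σ))) :
    Runs u (.storeReal a i e) σ (i.cost + e.cost + 1) Q := ⟨_, _, le_rfl, .storeReal a i e σ, h⟩

theorem seq (h : Runs u P σ T Q') (h' : ∀ σ', Frame P σ σ' → Q' σ' → Runs u P' σ' T' Q) :
    Runs u (P ;; P') σ (T + T') Q := by
  obtain ⟨t, σ', ht, hex, hq⟩ := h
  obtain ⟨t', σ'', ht', hex', hq'⟩ := h' σ' hex.frame hq
  exact ⟨t + t', σ'', by omega, .seq hex hex', hq'⟩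

/-- Sequential composition whose first part is a single step, so that the memory in between is
known explicitly. -/
theorem step (h : Runs u P σ T fun σ' => Runs u P' σ' T' Q) :
    Runs u (P ;; P') σ (T + T') Q :=
  h.seq fun _ _ h' => h'

theorem ite {b : BoolExpr} (h : b.Holds u σ → Runs u P σ T Q)
    (h' : ¬ b.Holds u σ → Runs u P' σ T' Q) :
    Runs u (.ite b P P') σ (b.cost + (T + T')) Q := by
  by_cases hb : b.Holds u σ
  · obtain ⟨t, σ', ht, hex, hq⟩ := h hb
    exact ⟨_, σ', by omega, .iteTrue hb hex, hq⟩
  · obtain ⟨t, σ', ht, hex, hq⟩ := h' hb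
    exact ⟨_, σ', by omega, .iteFalse hb hex, hq⟩

/-- The rule for loops. The natural number in the invariant is the number of elementary operations
that are still available; it serves as variant too. -/
theorem whileLoop {b : BoolExpr} (Inv : ℕ → State → Prop) {m : ℕ} (init : Inv m σ)
    (step : ∀ m σ', Frame P σ σ' → Inv m σ' → b.Holds u σ' →
      ∃ T m', b.cost + T + m' ≤ m ∧ Runs u P σ' T (Inv m'))
    (exit : ∀ m σ', Frame P σ σ' → Inv m σ' → ¬ b.Holds u σ' → b.cost ≤ m ∧ Q σ') :
    Runs u (.while b P) σ m Q := by
  suffices h : ∀ m σ', Frame P σ σ' → Inv m σ' → Runs u (.while b P) σ' m Q from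
    h m σ (Frame.refl _ _) init
  intro m
  induction m using Nat.strong_induction_on with
  | _ m ih =>
    intro σ' hf hI
    by_cases hb : b.Holds u σ'
    · obtain ⟨T, m', hm, t, σ'', ht, hex, hq⟩ := step m σ' hf hI hb
      have := b.cost_pos
      obtain ⟨t', σ₃, ht', hex', hq'⟩ := ih m' (by omega) σ'' (hf.trans hex.frame) hq
      exact ⟨_, σ₃, by omega, .whileTrue hb hex hex', hq'⟩
    · obtain ⟨hm, hq⟩ := exit m σ' hf hI hb
      exact ⟨_, σ', hm, .whileFalse hb, hq⟩

/-- The rule for counting loops: `Inv k` holds before the iteration with counter value `k`. A bound `T`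
on the cost of the body has to be uniform in `k`. -/
theorem forLoop {x y N : ℕ} (Inv : ℕ → State → Prop) (hx : P.keepsNat x = true)
    (hy : P.keepsNat y = true) (hxy : x ≠ y) (hN : σ.nat y = N)
    (init : Inv 0 (σ.setNat x 0))
    (step : ∀ k < N, ∀ σ', Frame (forLoop x y P) σ σ' → σ'.nat x = k → Inv k σ' →
      Runs u P σ' T fun σ'' => Inv (k + 1) (σ''.setNat x (k + 1)))
    (post : ∀ σ', Frame (forLoop x y P) σ σ' → Inv N σ' → Q σ') :
    Runs u (forLoop x y P) σ (N * (T + 8) + 6) Q := by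
  have hfr : ∀ σ', Frame (P ;; .setNat x (.add (.reg x) (.const 1))) (σ.setNat x 0) σ' →
      Frame (Program.forLoop x y P) σ σ' := by
    intro σ' hf
    refine Frame.trans (Exec.frame (u := u) (Exec.setNat x (.const 0) σ) |>.of_le ?_ ?_ ?_ ?_)
      (hf.of_le ?_ ?_ ?_ ?_) <;>
      simp +contextual [Program.forLoop, keepsNat, keepsReal, keepsNatArr, keepsRealArr]
  have key : Runs u (Program.forLoop x y P) σ (((NatExpr.const 0).cost + 1) + (N * (T + 8) + 4)) Q := by
    refine Runs.step (Runs.setNat ?_)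
    refine Runs.whileLoop (fun m σ' => ∃ k ≤ N, σ'.nat x = k ∧ σ'.nat y = N ∧ Inv k σ' ∧
      m = (N - k) * (T + 8) + 4) ?_ ?_ ?_
    · exact ⟨0, Nat.zero_le _, by simp [NatExpr.eval], by simp [hN, hxy.symm], init, by simp⟩
    · rintro m σ' hf ⟨k, hk, hkx, hky, hI, rfl⟩ hb
      have hlt : k < N := by
        simpa [BoolExpr.Holds, NatExpr.eval, hkx, hky] using hb
      refine ⟨T + 4, (N - (k + 1)) * (T + 8) + 4, ?_, ?_⟩
      · obtain ⟨d, rfl⟩ : ∃ d, N = k + 1 + d := ⟨N - (k + 1), by omega⟩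
        have h1 : k + 1 + d - k = d + 1 := by omega
        have h2 : k + 1 + d - (k + 1) = d := by omega
        simp only [h1, h2, BoolExpr.cost, NatExpr.cost]
        ring_nf
        omega
      · refine (Runs.seq (T' := 4) (step k hlt σ' (hfr σ' hf) hkx hI) ?_)
        intro σ'' hf' hI'
        refine Runs.setNat ?_
        have e : (NatExpr.add (.reg x) (.const 1)).eval σ'' = k + 1 := by
          simp [NatExpr.eval, hf'.nat x hx, hkx]
        rw [e]
        refine ⟨k + 1, hlt, by simp, ?_, hI', rfl⟩
        simp [hxy.symm, hf'.nat y hy, hky]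
    · rintro m σ' hf ⟨k, hk, hkx, hky, hI, rfl⟩ hb
      have hle : N ≤ k := by
        simpa [BoolExpr.Holds, NatExpr.eval, hkx, hky] using hb
      obtain rfl : k = N := le_antisymm hk hle
      exact ⟨by simp [BoolExpr.cost, NatExpr.cost], post σ' (hfr σ' hf) hI⟩
  exact key.mono (by simp only [NatExpr.cost]; omega)

end Runs

end FairScheduling

namespace FairScheduling

/-! ### Equal processing times with release dates and deadlines: forbidden regions -/

/-! In this part the jobs are numbered `0, …, n - 1` by non-increasing release dates `R`; `D j` is the
latest allowed starting time of job `j`. -/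

/-- `X` is a schedule of `n` jobs of length `p` with starting times between `R` and `D`. -/
structure MeetsDeadlines (n : ℕ) (p : ℝ) (R D X : ℕ → ℝ) : Prop where
  release : ∀ j < n, R j ≤ X j
  deadline : ∀ j < n, X j ≤ D j
  disjoint : ∀ i < n, ∀ j < n, i ≠ j → X i + p ≤ X j ∨ X j + p ≤ X i

/-- `x` lies in none of the open intervals `(L i, R i)` with `i < q`. -/
def Allowed (R L : ℕ → ℝ) (q : ℕ) (x : ℝ) : Prop :=
  ∀ i < q, ¬ (L i < x ∧ x < R i)

/-- The intervals `(L q, R q)`, for `q < m`, are the forbidden regions of the first `m` jobs.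

The number `c q j` is the earliest start that results when those of the jobs `0, …, q - 1` whose
deadline is at most `D j` are packed backwards from `D j`, avoiding the regions found before; it is
`D j + p` if there are no such jobs. In a schedule that meets the deadlines one of these jobs starts
at or before `c (q + 1) j` if `D q ≤ D j`. Since they are all released at or after `R q`, no job can
start between `c (q + 1) j - p` and `R q`: it would precede all of them and leave too little room.
`L q` is the smallest left end obtained in this way, or `R q` if the interval is to be empty. -/
structure IsForbidden (n m : ℕ) (p : ℝ) (R D L : ℕ → ℝ) (c : ℕ → ℕ → ℝ) : Prop where
  zero : ∀ j < n, c 0 j = D j + p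
  update : ∀ q < m, ∀ j < n, D q ≤ D j →
    IsGreatest {x | x ≤ c q j - p ∧ Allowed R L q x} (c (q + 1) j)
  keep : ∀ q < m, ∀ j < n, ¬ D q ≤ D j → c (q + 1) j = c q j
  left_le : ∀ q < m, ∀ j < n, D q ≤ D j → L q ≤ c (q + 1) j - p
  left_eq : ∀ q < m, L q = R q ∨ ∃ j < n, D q ≤ D j ∧ L q = c (q + 1) j - p

/-- `J 0, J 1, …` is the order in which the jobs are started by the rule "whenever possible outside
the intervals `(L i, R i)`, start an available job with the earliest deadline", and `t k` is the
starting time of `J k`, for `k < m`. -/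
structure IsGreedy (n m : ℕ) (p : ℝ) (R D L : ℕ → ℝ) (J : ℕ → ℕ) (t : ℕ → ℝ) : Prop where
  lt : ∀ k < m, J k < n
  inj : ∀ k < m, ∀ l < k, J l ≠ J k
  least : ∀ k < m, IsLeast {x | 0 ≤ x ∧ (∀ l, k = l + 1 → t l + p ≤ x) ∧
    (∃ q < n, (∀ l < k, J l ≠ q) ∧ R q ≤ x) ∧ Allowed R L n x} (t k)
  release : ∀ k < m, R (J k) ≤ t k
  earliest : ∀ k < m, ∀ q < n, (∀ l < k, J l ≠ q) → R q ≤ t k → D (J k) ≤ D q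

section

variable {n : ℕ} {p : ℝ} {R D L X : ℕ → ℝ} {c : ℕ → ℕ → ℝ}

/-- The number of jobs packed at stage `q` for the deadline of `j`. -/
noncomputable def packed (D : ℕ → ℝ) (q j : ℕ) : Finset ℕ := {i ∈ Finset.range q | D i ≤ D j}

theorem mem_packed {q j i : ℕ} : i ∈ packed D q j ↔ i < q ∧ D i ≤ D j := by
  simp [packed]

theorem card_packed_succ_of_le {q j : ℕ} (h : D q ≤ D j) :
    (packed D (q + 1) j).card = (packed D q j).card + 1 := by
  rw [packed, Finset.range_add_one, Finset.filter_insert, if_pos h, Finset.card_insert_of_notMem]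
  · rfl
  · simp

theorem packed_succ_of_not_le {q j : ℕ} (h : ¬ D q ≤ D j) :
    packed D (q + 1) j = packed D q j := by
  rw [packed, Finset.range_add_one, Finset.filter_insert, if_neg h]; rfl

/-- Backward packing is optimal: if as many jobs as are packed at stage `q`, all with deadline at most
`D j`, are preceded by a job starting at `y`, then `y ≤ c q j - p`. -/
theorem IsForbidden.le_sub (hc : IsForbidden n n p R D L c) (hX : MeetsDeadlines n p R D X)
    (hp : 0 < p) {q : ℕ} (hq : q ≤ n) (hall : ∀ j < n, Allowed R L q (X j)) {j : ℕ} (hj : j < n)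
    (V : Finset ℕ) (hVn : ∀ i ∈ V, i < n) (hVD : ∀ i ∈ V, D i ≤ D j)
    (hcard : V.card = (packed D q j).card) {y : ℝ} (hyD : y ≤ D j) (hyV : ∀ i ∈ V, y + p ≤ X i) :
    y ≤ c q j - p := by
  induction q generalizing V y with
  | zero => rw [hc.zero j hj]; linarith
  | succ q ih =>
    have hall' : ∀ j < n, Allowed R L q (X j) := fun j hj i hi => hall j hj i (by omega)
    by_cases hD : D q ≤ D j
    · rw [card_packed_succ_of_le hD] at hcard
      have hne : V.Nonempty := by
        rw [← Finset.card_pos]; omega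
      obtain ⟨a, ha, hmin⟩ := Finset.exists_min_image V X hne
      have h1 : X a ≤ c q j - p := by
        refine ih (by omega) hall' (V.erase a) (fun i hi => hVn i (Finset.mem_of_mem_erase hi))
          (fun i hi => hVD i (Finset.mem_of_mem_erase hi)) ?_
          ((hX.deadline a (hVn a ha)).trans (hVD a ha)) ?_
        · rw [Finset.card_erase_of_mem ha]; omega
        · intro i hi
          have hi' := Finset.mem_of_mem_erase hi
          have := hmin i hi'
          rcases hX.disjoint a (hVn a ha) i (hVn i hi') (Finset.ne_of_mem_erase hi).symm with h | h
          · exact h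
          · linarith
      have h2 : X a ≤ c (q + 1) j :=
        (hc.update q (by omega) j hj hD).2 ⟨h1, hall' a (hVn a ha)⟩
      have := hyV a ha
      linarith
    · rw [hc.keep q (by omega) j hj hD]
      rw [packed_succ_of_not_le hD] at hcard
      exact ih (by omega) hall' V hVn hVD hcard hyD hyV

/-- No schedule that meets the deadlines starts a job in a forbidden region. -/
theorem IsForbidden.allowed (hc : IsForbidden n n p R D L c) (hX : MeetsDeadlines n p R D X)
    (hp : 0 < p) (hR : ∀ i j, i ≤ j → j < n → R j ≤ R i) {q : ℕ} (hq : q ≤ n) :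
    ∀ j < n, Allowed R L q (X j) := by
  induction q with
  | zero => intro j _ i hi; omega
  | succ q ih =>
    intro a ha i hi
    rcases Nat.lt_succ_iff_lt_or_eq.1 hi with h | rfl
    · exact ih (by omega) a ha i h
    rintro ⟨h1, h2⟩
    rcases hc.left_eq i (by omega) with h | ⟨j, hj, hD, h⟩
    · linarith
    have hall := ih (by omega)
    have hin : i < n := by omega
    -- the packed jobs are released after the start of `a`, so all of them follow `a`
    have hafter : ∀ b ∈ packed D (i + 1) j, X a + p ≤ X b := by
      intro b hb
      rw [mem_packed] at hb
      have h3 := hR b i (by omega) hin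
      have h4 := hX.release b (by omega)
      rcases hX.disjoint a ha b (by omega) (by rintro rfl; linarith) with h | h
      · exact h
      · linarith
    have hXD : X a ≤ D j := by
      have h3 := hafter i (mem_packed.2 ⟨by omega, hD⟩)
      have h4 := hX.deadline i hin
      linarith
    have h5 : X i ≤ D j := (hX.deadline i hin).trans hD
    -- the first packed job starts at or before `c (i + 1) j`
    obtain ⟨b, hb, hmin⟩ := Finset.exists_min_image (packed D (i + 1) j) X
      ⟨i, mem_packed.2 ⟨by omega, hD⟩⟩
    have hb' := mem_packed.1 hb
    have h6 : X b ≤ c i j - p := by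
      refine hc.le_sub hX hp (by omega) hall hj ((packed D (i + 1) j).erase b)
        (fun x hx => ?_) (fun x hx => ?_) ?_ ((hX.deadline b (by omega)).trans hb'.2) ?_
      · have := (mem_packed.1 (Finset.mem_of_mem_erase hx)).1; omega
      · exact (mem_packed.1 (Finset.mem_of_mem_erase hx)).2
      · rw [Finset.card_erase_of_mem hb, card_packed_succ_of_le hD]; rfl
      · intro x hx
        have hx' := Finset.mem_of_mem_erase hx
        have := hmin x hx'
        rcases hX.disjoint b (by omega) x (by have := (mem_packed.1 hx').1; omega)
          (Finset.ne_of_mem_erase hx).symm with h | h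
        · exact h
        · linarith
    have h7 : X b ≤ c (i + 1) j := (hc.update i hin j hj hD).2 ⟨h6, hall b (by omega)⟩
    have := hafter b hb
    linarith

/-- If the deadlines can be met then the backward packings respect the release dates. -/
theorem IsForbidden.release_le (hc : IsForbidden n n p R D L c) (hX : MeetsDeadlines n p R D X)
    (hp : 0 < p) (hR : ∀ i j, i ≤ j → j < n → R j ≤ R i) {q j : ℕ} (hq : q < n) (hj : j < n)
    (hD : D q ≤ D j) : R q ≤ c (q + 1) j := by
  obtain ⟨b, hb, hmin⟩ := Finset.exists_min_image (packed D (q + 1) j) X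
    ⟨q, mem_packed.2 ⟨by omega, hD⟩⟩
  have hb' := mem_packed.1 hb
  have h := hc.le_sub hX hp (q := q + 1) (by omega) (hc.allowed hX hp hR (by omega)) hj
    (packed D (q + 1) j) (fun x hx => by have := (mem_packed.1 hx).1; omega)
    (fun x hx => (mem_packed.1 hx).2) rfl (y := X b - p)
    (by have := hX.deadline b (by omega); have := hb'.2; linarith)
    (fun i hi => by have := hmin i hi; linarith)
  have h1 := hX.release b (by omega)
  have h2 := hR b q (by omega) hq
  linarith

variable {J : ℕ → ℕ} {t : ℕ → ℝ}

/-- Outside the regions of the later jobs, too, the backward packings avoid the forbidden regions,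
since those regions lie before `R q ≤ c (q + 1) j`. -/
theorem IsForbidden.allowed_packing (hc : IsForbidden n n p R D L c)
    (hX : MeetsDeadlines n p R D X) (hp : 0 < p) (hR : ∀ i j, i ≤ j → j < n → R j ≤ R i)
    {j : ℕ} (hj : j < n) {q : ℕ} (hq : q ≤ n) (hne : (packed D q j).Nonempty) :
    Allowed R L n (c q j) := by
  induction q with
  | zero => obtain ⟨i, hi⟩ := hne; simp [mem_packed] at hi
  | succ q ih =>
    by_cases hD : D q ≤ D j
    · intro i hi
      rcases lt_or_ge i q with h | h
      · exact (hc.update q (by omega) j hj hD).1.2 i h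
      · rintro ⟨_, h2⟩
        have h3 := hR q i h hi
        have h4 := hc.release_le hX hp hR (by omega) hj hD
        linarith
    · rw [hc.keep q (by omega) j hj hD]
      rw [packed_succ_of_not_le hD] at hne
      exact ih (by omega) hne

/-- Along a stretch `m, …, k` without voluntary idle time, backward packing from the missed
deadline of `J k` stays strictly ahead of the greedy schedule. -/
theorem IsGreedy.packing_lt (hc : IsForbidden n n p R D L c) (hX : MeetsDeadlines n p R D X)
    (hp : 0 < p) (hR : ∀ i j, i ≤ j → j < n → R j ≤ R i) (ht : IsGreedy n n p R D L J t)
    {m k : ℕ} (hmk : m ≤ k) (hk : k < n) (hmiss : D (J k) < t k)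
    (hbusy : ∀ l, m ≤ l → l < k → ∃ q < n, (∀ i < l + 1, J i ≠ q) ∧ R q ≤ t l + p)
    {q : ℕ} (hq : q ≤ n) (hne : (packed D q (J k)).Nonempty) :
    ∃ l, m ≤ l ∧ l ≤ k ∧ (l = m ∨ l + (packed D q (J k)).card = k + 1) ∧ c q (J k) < t l := by
  have hj := ht.lt k hk
  have hnn : ∀ l, l ≤ k → 0 ≤ t l := fun l hl => (ht.least l (by omega)).1.1
  induction q with
  | zero => obtain ⟨i, hi⟩ := hne; simp [mem_packed] at hi
  | succ q ih =>
    by_cases hD : D q ≤ D (J k)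
    · have hup := hc.update q (by omega) (J k) hj hD
      have hle := hup.1.1
      rw [card_packed_succ_of_le hD]
      rcases Finset.eq_empty_or_nonempty (packed D q (J k)) with he | hne'
      · refine ⟨k, hmk, le_rfl, Or.inr (by simp [he]), ?_⟩
        have h0 : ∀ i ≤ q, c i (J k) = D (J k) + p := by
          intro i hi
          induction i with
          | zero => exact hc.zero _ hj
          | succ i ih' =>
            rw [hc.keep i (by omega) _ hj, ih' (by omega)]
            intro h
            have : i ∈ packed D q (J k) := mem_packed.2 ⟨by omega, h⟩
            simp [he] at this
        rw [h0 q le_rfl] at hle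
        linarith
      · obtain ⟨l, hml, hlk, hl, hlt⟩ := ih (by omega) hne'
        rcases hl with rfl | hl
        · exact ⟨l, le_rfl, hlk, Or.inl rfl, by linarith⟩
        · rcases hml.eq_or_lt with rfl | hml
          · exact ⟨m, le_rfl, hlk, Or.inl rfl, by linarith⟩
          obtain ⟨l, rfl⟩ : ∃ a, l = a + 1 := ⟨l - 1, by omega⟩
          refine ⟨l, by omega, by omega, Or.inr (by omega), ?_⟩
          by_contra! hcon
          obtain ⟨a, ha, haU, haR⟩ := hbusy l (by omega) (by omega)
          have : t (l + 1) ≤ c q (J k) := (ht.least (l + 1) (by omega)).2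
            ⟨by have := hnn l (by omega); linarith, fun l' hl' => by
              obtain rfl : l = l' := by omega
              linarith, ⟨a, ha, haU, by linarith⟩,
              hc.allowed_packing hX hp hR hj (by omega) hne'⟩
          linarith
    · rw [hc.keep q (by omega) _ hj hD]
      rw [packed_succ_of_not_le hD] at hne ⊢
      exact ih (by omega) hne

/-- If the deadlines can be met at all, the greedy schedule that avoids the forbidden regions meets
them. -/
theorem IsGreedy.le_deadline (hc : IsForbidden n n p R D L c) (hX : MeetsDeadlines n p R D X)
    (hp : 0 < p) (hR : ∀ i j, i ≤ j → j < n → R j ≤ R i) (ht : IsGreedy n n p R D L J t)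
    (hR0 : ∀ j < n, 0 ≤ R j) {k : ℕ} (hk : k < n) : t k ≤ D (J k) := by
  by_contra! hmiss
  have hj := ht.lt k hk
  -- `m` is the start of the longest busy stretch before `k` of jobs with deadline at most `D (J k)`
  obtain ⟨m, ⟨hmk, hgood⟩, hmin⟩ : ∃ m, (m ≤ k ∧ ∀ l, m ≤ l → l < k → D (J l) ≤ D (J k) ∧
      ∃ q < n, (∀ i < l + 1, J i ≠ q) ∧ R q ≤ t l + p) ∧
      ∀ m', (m' ≤ k ∧ ∀ l, m' ≤ l → l < k → D (J l) ≤ D (J k) ∧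
      ∃ q < n, (∀ i < l + 1, J i ≠ q) ∧ R q ≤ t l + p) → m ≤ m' := by
    classical
    have hex : ∃ m, m ≤ k ∧ ∀ l, m ≤ l → l < k → D (J l) ≤ D (J k) ∧
      ∃ q < n, (∀ i < l + 1, J i ≠ q) ∧ R q ≤ t l + p := ⟨k, le_rfl, fun l h h' => by omega⟩
    exact ⟨Nat.find hex, Nat.find_spec hex, fun m' h => Nat.find_min' hex h⟩
  have hDle : ∀ l, m ≤ l → l ≤ k → D (J l) ≤ D (J k) := fun l h h' => by
    rcases h'.eq_or_lt with rfl | h'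
    · exact le_rfl
    · exact (hgood l h h').1
  -- `q` has the earliest release date among the jobs of this stretch
  obtain ⟨b, hb, hbmax⟩ := Finset.exists_max_image (Finset.Icc m k) J ⟨k, by simp [hmk]⟩
  rw [Finset.mem_Icc] at hb
  obtain ⟨q, hqdef⟩ : ∃ q, q = J b := ⟨_, rfl⟩
  have hq : q < n := hqdef ▸ ht.lt b (by omega)
  have hqD : D q ≤ D (J k) := hqdef ▸ hDle b hb.1 hb.2
  have hqU : ∀ l < m, J l ≠ q := fun l hl => hqdef ▸ ht.inj b (by omega) l (by omega)
  have hne : (packed D (q + 1) (J k)).Nonempty := ⟨q, mem_packed.2 ⟨by omega, hqD⟩⟩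
  have hcard : k + 1 - m ≤ (packed D (q + 1) (J k)).card := by
    have hinj : Set.InjOn J (Finset.Icc m k : Finset ℕ) := by
      intro x hx y hy hxy
      simp only [Finset.coe_Icc, Set.mem_Icc] at hx hy
      rcases lt_trichotomy x y with h | h | h
      · exact absurd hxy (ht.inj y (by omega) x h)
      · exact h
      · exact absurd hxy.symm (ht.inj x (by omega) y h)
    rw [← Nat.card_Icc, ← Finset.card_image_of_injOn hinj]
    refine Finset.card_le_card fun x hx => ?_
    obtain ⟨l, hl, rfl⟩ := Finset.mem_image.1 hx
    have h1 := hbmax l hl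
    rw [Finset.mem_Icc] at hl
    exact mem_packed.2 ⟨by omega, hDle l hl.1 hl.2⟩
  obtain ⟨l, hml, hlk, hl, hlt⟩ := IsGreedy.packing_lt hc hX hp hR ht hmk hk hmiss
    (fun l h h' => (hgood l h h').2) (q := q + 1) (by omega) hne
  obtain rfl : l = m := by omega
  have hRc := hc.release_le hX hp hR hq hj hqD
  have hall := hc.allowed_packing hX hp hR hj (q := q + 1) (by omega) hne
  have h0 := hR0 q hq
  -- the packing could only be ahead of the greedy schedule because of the previous job
  obtain ⟨i, rfl, hi⟩ : ∃ i, l = i + 1 ∧ c (q + 1) (J k) < t i + p := by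
    by_contra! hcon
    have : t l ≤ c (q + 1) (J k) := (ht.least l (by omega)).2
      ⟨by linarith, hcon, ⟨q, hq, hqU, hRc⟩, hall⟩
    linarith
  have hDi : D (J k) < D (J i) := by
    by_contra! hcon
    have := hmin i ⟨by omega, fun l h h' => by
      rcases h.eq_or_lt with rfl | h
      · exact ⟨hcon, q, hq, hqU, by linarith⟩
      · exact hgood l h h'⟩
    omega
  have hRq : t i < R q := by
    by_contra! hcon
    have := ht.earliest i (by omega) q hq (fun l hl => hqU l (by omega)) hcon
    linarith
  refine (ht.least i (by omega)).1.2.2.2 q hq ⟨?_, hRq⟩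
  have := hc.left_le q hq _ hj hqD
  linarith

end

end FairScheduling

namespace FairScheduling

/-! ### Semi-active schedules -/

/-- The time at which the machine becomes free when jobs with release dates `ρ 0, …, ρ (k - 1)` are
started in this order, each as early as possible. -/
noncomputable def freeTime (p : ℝ) (ρ : ℕ → ℝ) : ℕ → ℝ
  | 0 => 0
  | k + 1 => max (freeTime p ρ k) (ρ k) + p

theorem freeTime_add_le {p : ℝ} {ρ : ℕ → ℝ} (hp : 0 ≤ p) {k l : ℕ} (hkl : k < l) :
    max (freeTime p ρ k) (ρ k) + p ≤ freeTime p ρ l := by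
  induction l with
  | zero => omega
  | succ l ih =>
    rcases Nat.lt_succ_iff_lt_or_eq.1 hkl with h | rfl
    · have := le_max_left (freeTime p ρ l) (ρ l)
      simp only [freeTime]
      linarith [ih h]
    · exact le_rfl

theorem exists_eq_of_injOn {n : ℕ} {π : ℕ → ℕ} (hlt : ∀ k < n, π k < n)
    (hinj : ∀ k < n, ∀ l < n, π k = π l → k = l) {j : ℕ} (hj : j < n) : ∃ k < n, π k = j := by
  have h : Function.Injective fun k : Fin n => (⟨π k, hlt k k.2⟩ : Fin n) := by
    intro k l hkl
    exact Fin.ext (hinj k k.2 l l.2 (by simpa using hkl))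
  obtain ⟨k, hk⟩ := Finite.surjective_of_injective h ⟨j, hj⟩
  exact ⟨k, k.2, by simpa using congrArg Fin.val hk⟩

namespace Problem

variable {n : ℕ} (I : Problem n)

theorem le_uMin_iff (hn : 0 < n) {s : Fin n → ℝ} {v : ℝ} :
    v ≤ I.uMin s ↔ ∀ j, v ≤ I.u j (s j + I.p) := by
  have : Nonempty (Fin n) := ⟨⟨0, hn⟩⟩
  exact le_ciInf_iff (Set.finite_range _).bddBelow

theorem exists_uMin_eq (hn : 0 < n) (s : Fin n → ℝ) : ∃ j, I.uMin s = I.u j (s j + I.p) := by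
  have : Nonempty (Fin n) := ⟨⟨0, hn⟩⟩
  obtain ⟨j, hj⟩ := exists_eq_ciInf_of_finite (f := fun j => I.u j (s j + I.p))
  exact ⟨j, hj.symm⟩

variable {I}

theorem semiActive_of_forall {s : Fin n → ℝ} (h : ∀ j, s j = I.r j ∨ ∃ i, s j = s i + I.p) :
    I.SemiActive s := by
  rintro j t ht ⟨⟨hrel, hdis⟩, hord⟩
  rcases h j with hj | ⟨i, hi⟩
  · have := hrel j
    simp only [Function.update_self] at this
    linarith
  · have hp := I.p_pos
    have hij : i ≠ j := by rintro rfl; linarith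
    have h1 := (hord i j).1 (by linarith)
    have h2 := hdis i j hij
    simp only [Function.update_self, Function.update_of_ne hij] at h1 h2
    rcases h2 with h2 | h2 <;> linarith

/-- In a semi-active schedule every job starts at its release date or directly after another one. -/
theorem SemiActive.eq_release_or {s : Fin n → ℝ} (hf : I.Feasible s) (hs : I.SemiActive s)
    (j : Fin n) : s j = I.r j ∨ ∃ i, s i < s j ∧ s j = s i + I.p := by
  by_contra! hcon
  obtain ⟨hr, hi⟩ := hcon
  have hp := I.p_pos
  -- otherwise `j` could start at `t`, the first moment allowed by its predecessors
  obtain ⟨t, ht, htr, hti⟩ : ∃ t < s j, I.r j ≤ t ∧ ∀ i, s i < s j → s i + I.p ≤ t := by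
    let F : Finset ℝ := insert (I.r j)
      ((Finset.univ.filter fun i => s i < s j).image fun i => s i + I.p)
    have hne : F.Nonempty := Finset.insert_nonempty _ _
    refine ⟨F.max' hne, ?_, F.le_max' _ (Finset.mem_insert_self _ _), fun i h =>
      F.le_max' _ (Finset.mem_insert_of_mem (Finset.mem_image.2 ⟨i, by simpa using h, rfl⟩))⟩
    rw [Finset.max'_lt_iff]
    intro y hy
    rcases Finset.mem_insert.1 hy with rfl | hy
    · exact lt_of_le_of_ne (hf.1 j) hr.symm
    · obtain ⟨i, h, rfl⟩ := Finset.mem_image.1 hy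
      have hlt : s i < s j := by simpa using h
      refine lt_of_le_of_ne ?_ (hi i hlt).symm
      rcases hf.2 i j (by rintro rfl; exact lt_irrefl _ hlt) with h | h
      · exact h
      · linarith
  refine hs j t ht ⟨⟨fun i => ?_, fun a b hab => ?_⟩, fun a b => ?_⟩
  · by_cases hij : i = j
    · subst hij; simpa using htr
    · simpa [Function.update_of_ne hij] using hf.1 i
  · have key : ∀ i, i ≠ j → s i + I.p ≤ t ∨ t + I.p ≤ s i := by
      intro i hij
      rcases hf.2 i j hij with h | h
      · exact Or.inl (hti i (by linarith))
      · exact Or.inr (by linarith)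
    by_cases ha : a = j
    · subst ha
      simpa [Function.update_of_ne hab.symm] using (key b hab.symm).symm
    · by_cases hb : b = j
      · subst hb
        simpa [Function.update_of_ne ha] using key a ha
      · simpa [Function.update_of_ne ha, Function.update_of_ne hb] using hf.2 a b hab
  · by_cases ha : a = j
    · by_cases hb : b = j
      · subst ha; subst hb; simp
      · subst ha
        simp only [Function.update_self, Function.update_of_ne hb]
        refine ⟨fun h => by linarith, fun h => ?_⟩
        rcases hf.2 b a hb with h' | h'
        · have := hti b (by linarith); linarith
        · linarith
    · by_cases hb : b = j
      · subst hb
        simp only [Function.update_self, Function.update_of_ne ha]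
        exact ⟨fun h => by have := hti a h; linarith, fun h => by linarith⟩
      · simp [Function.update_of_ne ha, Function.update_of_ne hb]

/-- The starting times of a semi-active schedule lie in the grid `r i + k p`, `k < n`. -/
theorem exists_start_eq {s : Fin n → ℝ} (hs : s ∈ I.schedules) (j : Fin n) :
    ∃ i : Fin n, ∃ k < n, s j = I.r i + k * I.p := by
  have key : ∀ m, ∀ j, (Finset.univ.filter fun i => s i < s j).card = m →
      ∃ i : Fin n, ∃ k ≤ m, s j = I.r i + k * I.p := by
    intro m
    induction m using Nat.strong_induction_on with
    | _ m ih =>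
      intro j hm
      rcases SemiActive.eq_release_or hs.1 hs.2 j with h | ⟨i, hlt, h⟩
      · exact ⟨j, 0, Nat.zero_le _, by simp [h]⟩
      · have hcard : (Finset.univ.filter fun a => s a < s i).card < m := by
          rw [← hm]
          refine Finset.card_lt_card (Finset.ssubset_iff_of_subset ?_ |>.2 ⟨i, by simpa, by simp⟩)
          intro a ha
          simp only [Finset.mem_filter, Finset.mem_univ, true_and] at ha ⊢
          linarith
        obtain ⟨a, k, hk, hak⟩ := ih _ hcard i rfl
        refine ⟨a, k + 1, by omega, ?_⟩
        rw [h, hak]; push_cast; ring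
  obtain ⟨i, k, hk, h⟩ := key _ j rfl
  refine ⟨i, k, lt_of_le_of_lt hk ?_, h⟩
  calc (Finset.univ.filter fun i => s i < s j).card
      < (Finset.univ : Finset (Fin n)).card :=
        Finset.card_lt_card (Finset.ssubset_iff_of_subset (Finset.subset_univ _) |>.2
          ⟨j, by simp, by simp⟩)
    _ = n := by simp

/-- Starting the jobs in a given order, each as early as possible, gives a semi-active schedule. -/
theorem mem_schedules_of_order {π : ℕ → ℕ} {ρ : ℕ → ℝ} (hlt : ∀ k < n, π k < n)
    (hinj : ∀ k < n, ∀ l < n, π k = π l → k = l)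
    (hρ : ∀ k (hk : k < n), ρ k = I.r ⟨π k, hlt k hk⟩) {s : Fin n → ℝ}
    (hs : ∀ k (hk : k < n), s ⟨π k, hlt k hk⟩ = max (freeTime I.p ρ k) (ρ k)) :
    s ∈ I.schedules := by
  have hp := I.p_pos
  have hex : ∀ j : Fin n, ∃ k, ∃ hk : k < n, j = ⟨π k, hlt k hk⟩ := by
    intro j
    obtain ⟨k, hk, h⟩ := exists_eq_of_injOn hlt hinj j.2
    exact ⟨k, hk, Fin.ext h.symm⟩
  refine ⟨⟨fun j => ?_, fun i j hij => ?_⟩, semiActive_of_forall fun j => ?_⟩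
  · obtain ⟨k, hk, rfl⟩ := hex j
    rw [hs k hk, ← hρ k hk]
    exact le_max_right _ _
  · obtain ⟨k, hk, rfl⟩ := hex i
    obtain ⟨l, hl, rfl⟩ := hex j
    rw [hs k hk, hs l hl]
    rcases lt_trichotomy k l with h | rfl | h
    · exact Or.inl ((freeTime_add_le hp.le h).trans (le_max_left _ _))
    · exact absurd rfl hij
    · exact Or.inr ((freeTime_add_le hp.le h).trans (le_max_left _ _))
  · obtain ⟨k, hk, rfl⟩ := hex j
    rw [hs k hk, ← hρ k hk]
    rcases le_total (freeTime I.p ρ k) (ρ k) with h | h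
    · exact Or.inl (max_eq_right h)
    · cases k with
      | zero =>
        have h0 := I.r_nonneg ⟨π 0, hlt 0 hk⟩
        rw [← hρ 0 hk] at h0
        exact Or.inl (max_eq_right h0)
      | succ k =>
        refine Or.inr ⟨⟨π k, hlt k (by omega)⟩, ?_⟩
        rw [max_eq_left h, hs k (by omega)]
        rfl

end Problem

/-- Starting the jobs in the order of a greedy schedule, each as early as possible, delays none. -/
theorem IsGreedy.freeTime_le {n : ℕ} {p : ℝ} {R D L : ℕ → ℝ} {J : ℕ → ℕ} {t : ℕ → ℝ}
    (ht : IsGreedy n n p R D L J t) {k : ℕ} (hk : k < n) :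
    max (freeTime p (fun k => R (J k)) k) (R (J k)) ≤ t k := by
  refine max_le ?_ (ht.release k hk)
  induction k with
  | zero => exact (ht.least 0 hk).1.1
  | succ k ih =>
    have h1 := max_le (ih (by omega)) (ht.release k (by omega))
    have h2 := (ht.least (k + 1) hk).1.2.1 k rfl
    simp only [freeTime]
    linarith

end FairScheduling

namespace FairScheduling

open Program

/-! ### The program for the deadlines -/

/-- Raises the deadline of job `nat 1` to the grid time `real 3` if the job, started then, has at
least the utility `real 4`; advances the grid time. -/
def deadlineStep : Program :=
  .ite (.and (.realLe (.reg 4) (.util (.cell 0 (.reg 1)) (.add (.reg 3) (.reg 0))))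
      (.realLe (.cell 5 (.reg 1)) (.reg 3)))
    (.storeReal 5 (.reg 1) (.reg 3)) .skip ;;
  .setReal 3 (.add (.reg 3) (.reg 0))

/-- Considers the grid times `r i + k p`, for `i = nat 2` and all `k`. -/
def deadlineRow : Program :=
  .setReal 3 (.cell 0 (.reg 2)) ;; forLoop 3 0 deadlineStep

/-- Computes into real array `5` the latest grid times at which the jobs may start so as to have at
least the utility `real 4`, and `-1` where there are none. -/
def deadlineProgram : Program :=
  forLoop 1 0 (.storeReal 5 (.reg 1) (.const (-1)) ;; forLoop 2 0 deadlineRow)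

variable {u : ℕ → ℝ → ℝ} {σ : State} {n : ℕ}

theorem runs_deadlineRow (hn : σ.nat 0 = n) {q : ℕ} (hq : σ.nat 1 = q) :
    Runs u deadlineRow σ (n * 33 + 9) fun σ' =>
      (∀ q' ≠ q, σ'.realArr 5 q' = σ.realArr 5 q') ∧ σ.realArr 5 q ≤ σ'.realArr 5 q ∧
      (σ'.realArr 5 q = σ.realArr 5 q ∨
        σ.real 4 ≤ u (σ.natArr 0 q) (σ'.realArr 5 q + σ.real 0)) ∧
      ∀ k < n, σ.real 4 ≤ u (σ.natArr 0 q)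
          (σ.realArr 0 (σ.nat 2) + k * σ.real 0 + σ.real 0) →
        σ.realArr 0 (σ.nat 2) + k * σ.real 0 ≤ σ'.realArr 5 q := by
  unfold deadlineRow
  apply Runs.mono
  · apply Runs.step
    apply Runs.setReal
    apply Runs.forLoop (N := n) (fun m σ' =>
      σ'.real 3 = σ.realArr 0 (σ.nat 2) + m * σ.real 0 ∧
      (∀ q' ≠ q, σ'.realArr 5 q' = σ.realArr 5 q') ∧ σ.realArr 5 q ≤ σ'.realArr 5 q ∧
      (σ'.realArr 5 q = σ.realArr 5 q ∨
        σ.real 4 ≤ u (σ.natArr 0 q) (σ'.realArr 5 q + σ.real 0)) ∧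
      ∀ k < m, σ.real 4 ≤ u (σ.natArr 0 q)
          (σ.realArr 0 (σ.nat 2) + k * σ.real 0 + σ.real 0) →
        σ.realArr 0 (σ.nat 2) + k * σ.real 0 ≤ σ'.realArr 5 q) rfl rfl (by decide)
    · simpa using hn
    · simp [RealExpr.eval, NatExpr.eval]
    · rintro k hk σ' hf hk' ⟨h3, h5, h5', h5'', hall⟩
      have f0 := hf.real 0 rfl
      have f4 := hf.real 4 rfl
      have fn1 := hf.nat 1 rfl
      have fa := hf.natArr 0 rfl
      simp at f0 f4 fn1 fa
      refine Runs.step (Runs.ite (fun h => Runs.storeReal (Runs.setReal ?_)) fun h =>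
        Runs.skip (Runs.setReal ?_))
      · simp [BoolExpr.Holds, RealExpr.eval, NatExpr.eval, f0, f4, fn1, fa, h3, hq] at h ⊢
        refine ⟨by ring, fun q' hq' => ?_, by linarith, Or.inr h.1, fun k' hk' hu => ?_⟩
        · simp [Function.update_of_ne hq', h5 q' hq']
        · rcases hk'.lt_or_eq with h' | rfl
          · simpa using (hall k' h' hu).trans h.2
          · exact le_rfl
      · simp [BoolExpr.Holds, RealExpr.eval, NatExpr.eval, f0, f4, fn1, fa, h3, hq] at h ⊢
        refine ⟨by ring, h5, h5', h5'', fun k' hk' hu => ?_⟩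
        rcases hk'.lt_or_eq with h' | rfl
        · exact hall k' h' hu
        · exact (h hu).le
    · rintro σ' hf ⟨_, h⟩
      exact h
  · simp [BoolExpr.cost, RealExpr.cost, NatExpr.cost]
    omega

theorem runs_deadlineProgram (hn : σ.nat 0 = n) :
    Runs u deadlineProgram σ (n * (n * (n * 33 + 17) + 17) + 6) fun σ' => ∀ q < n,
      (∀ i < n, ∀ k < n,
        σ.real 4 ≤ u (σ.natArr 0 q) (σ.realArr 0 i + (k : ℕ) * σ.real 0 + σ.real 0) →
        σ.realArr 0 i + k * σ.real 0 ≤ σ'.realArr 5 q) ∧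
      (σ'.realArr 5 q = -1 ∨ σ.real 4 ≤ u (σ.natArr 0 q) (σ'.realArr 5 q + σ.real 0)) := by
  unfold deadlineProgram
  apply Runs.mono
  · apply Runs.forLoop (N := n) (fun m σ' => ∀ q < m,
      (∀ i < n, ∀ k < n,
        σ.real 4 ≤ u (σ.natArr 0 q) (σ.realArr 0 i + (k : ℕ) * σ.real 0 + σ.real 0) →
        σ.realArr 0 i + k * σ.real 0 ≤ σ'.realArr 5 q) ∧
      (σ'.realArr 5 q = -1 ∨ σ.real 4 ≤ u (σ.natArr 0 q) (σ'.realArr 5 q + σ.real 0)))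
      rfl rfl (by decide)
    · exact hn
    · intro q hq; omega
    · intro q hqn σ₁ hf₁ hq₁ hI
      apply Runs.step
      apply Runs.storeReal
      apply Runs.forLoop (N := n) (fun m σ' =>
        (∀ q' < q, σ'.realArr 5 q' = σ₁.realArr 5 q') ∧
        (∀ i < m, ∀ k < n,
          σ.real 4 ≤ u (σ.natArr 0 q) (σ.realArr 0 i + (k : ℕ) * σ.real 0 + σ.real 0) →
          σ.realArr 0 i + k * σ.real 0 ≤ σ'.realArr 5 q) ∧
        (σ'.realArr 5 q = -1 ∨ σ.real 4 ≤ u (σ.natArr 0 q) (σ'.realArr 5 q + σ.real 0)))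
        rfl rfl (by decide)
      · simpa [hn] using hf₁.nat 0 rfl
      · simp +contextual [RealExpr.eval, NatExpr.eval, hq₁, Function.update_of_ne, Nat.ne_of_lt]
      · rintro i hi σ₂ hf₂ hi₂ ⟨h1, h2, h3⟩
        have e4 : σ₂.real 4 = σ.real 4 := (hf₂.real 4 rfl).trans (hf₁.real 4 rfl)
        have e0 : σ₂.real 0 = σ.real 0 := (hf₂.real 0 rfl).trans (hf₁.real 0 rfl)
        have en : σ₂.nat 0 = n := (hf₂.nat 0 rfl).trans ((hf₁.nat 0 rfl).trans hn)
        have eq : σ₂.nat 1 = q := (hf₂.nat 1 rfl).trans hq₁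
        have ea : σ₂.natArr 0 = σ.natArr 0 := (hf₂.natArr 0 rfl).trans (hf₁.natArr 0 rfl)
        have er : σ₂.realArr 0 = σ.realArr 0 := (hf₂.realArr 0 rfl).trans (hf₁.realArr 0 rfl)
        refine (runs_deadlineRow en eq).imp ?_
        rintro σ₃ hf₃ ⟨g1, g2, g3, g4⟩
        simp only [e4, e0, ea, er, hi₂] at g3 g4
        refine ⟨fun q' hq' => (g1 q' hq'.ne).trans (h1 q' hq'), fun i' hi' k hk hu => ?_, ?_⟩
        · rcases Nat.lt_succ_iff_lt_or_eq.1 hi' with h | rfl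
          · exact (h2 i' h k hk hu).trans g2
          · exact g4 k hk hu
        · rcases g3 with g3 | g3
          · simpa [g3] using h3
          · exact Or.inr g3
      · rintro σ₂ hf₂ ⟨h1, h2, h3⟩ q' hq'
        rcases Nat.lt_succ_iff_lt_or_eq.1 hq' with h | rfl
        · simpa [h1 q' h] using hI q' h
        · exact ⟨h2, h3⟩
    · exact fun σ' _ h => h
  · simp only [RealExpr.cost, NatExpr.cost]
    ring_nf
    omega

end FairScheduling

namespace FairScheduling

open Program

/-! ### The program for the forbidden regions -/

theorem Allowed.congr {R L L' : ℕ → ℝ} {q : ℕ} {x : ℝ} (h : ∀ i < q, L' i = L i) :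
    Allowed R L' q x ↔ Allowed R L q x := by
  unfold Allowed
  exact forall₂_congr fun i hi => by rw [h i hi]

/-- One step of the search for the last allowed time up to `b`: since the right ends `R i` decrease,
leaving the interval `(L m, R m)` to the left cannot lead into an earlier one. -/
theorem isGreatest_allowed_succ {R L : ℕ → ℝ} {m : ℕ} {b x : ℝ} (hR : ∀ i < m, R m ≤ R i)
    (h : IsGreatest {y | y ≤ b ∧ Allowed R L m y} x) :
    IsGreatest {y | y ≤ b ∧ Allowed R L (m + 1) y} (if L m < x ∧ x < R m then L m else x) := by
  obtain ⟨⟨hxb, hx⟩, hub⟩ := h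
  have hub' : ∀ y, y ≤ b → Allowed R L m y → y ≤ x := fun y h h' => hub ⟨h, h'⟩
  split_ifs with hc
  · refine ⟨⟨by linarith [hc.1], fun i hi => ?_⟩, fun y hy => ?_⟩
    · rcases Nat.lt_succ_iff_lt_or_eq.1 hi with h | rfl
      · rintro ⟨h1, h2⟩
        exact hx i h ⟨h1.trans hc.1, hc.2.trans_le (hR i h)⟩
      · simp
    · have h1 := hub' y hy.1 fun i hi => hy.2 i (by omega)
      have h2 := hy.2 m (by omega)
      by_contra! h3
      exact h2 ⟨h3, by linarith⟩
  · refine ⟨⟨hxb, fun i hi => ?_⟩, fun y hy => hub' y hy.1 fun i hi => hy.2 i (by omega)⟩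
    rcases Nat.lt_succ_iff_lt_or_eq.1 hi with h | rfl
    · exact hx i h
    · exact hc

/-- The regions of the first `m` jobs can be extended by that of job `m`, which begins at `L' m`; the
numbers `C j` are the new starts of the backward packings. -/
theorem IsForbidden.succ {n m : ℕ} {p : ℝ} {R D L L' C : ℕ → ℝ} {c : ℕ → ℕ → ℝ}
    (hc : IsForbidden n m p R D L c) (hL : ∀ i < m, L' i = L i)
    (hup : ∀ j < n, D m ≤ D j →
      IsGreatest {x | x ≤ c m j - p ∧ Allowed R L m x} (C j) ∧ L' m ≤ C j - p)
    (hkeep : ∀ j < n, ¬ D m ≤ D j → C j = c m j)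
    (heq : L' m = R m ∨ ∃ j < n, D m ≤ D j ∧ L' m = C j - p) :
    IsForbidden n (m + 1) p R D L' fun s j => if s ≤ m then c s j else C j := by
  have hA : ∀ q ≤ m, ∀ x, Allowed R L' q x ↔ Allowed R L q x := fun q hq x =>
    Allowed.congr fun i hi => hL i (by omega)
  refine ⟨fun j hj => by simpa using hc.zero j hj, fun q hq j hj hD => ?_, fun q hq j hj hD => ?_,
    fun q hq j hj hD => ?_, fun q hq => ?_⟩ <;>
  rcases Nat.lt_succ_iff_lt_or_eq.1 hq with h | rfl
  · simpa [h.le, Nat.succ_le_of_lt h, hA q h.le] using hc.update q h j hj hD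
  · simpa [hA q le_rfl] using (hup j hj hD).1
  · simpa [h.le, Nat.succ_le_of_lt h] using hc.keep q h j hj hD
  · simpa using hkeep j hj hD
  · simpa [Nat.succ_le_of_lt h, hL q h] using hc.left_le q h j hj hD
  · simpa using (hup j hj hD).2
  · simpa [Nat.succ_le_of_lt h, hL q h] using hc.left_eq q h
  · simpa using heq

/-- Moves `real 3` to the last time up to `real 3` that lies outside the regions found so far. -/
def retreatProgram : Program :=
  forLoop 3 1 (.ite (.and (.not (.realLe (.reg 3) (.cell 7 (.reg 3))))
      (.not (.realLe (.cell 4 (.reg 3)) (.reg 3))))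
    (.setReal 3 (.cell 7 (.reg 3))) .skip)

/-- Packs job `nat 1` in front of the jobs already packed for the deadline of job `nat 2`. -/
def regionColumn : Program :=
  .ite (.realLe (.cell 5 (.reg 1)) (.cell 5 (.reg 2)))
    (.setReal 3 (.sub (.cell 6 (.reg 2)) (.reg 0)) ;;
      retreatProgram ;;
      .storeReal 6 (.reg 2) (.reg 3) ;;
      .ite (.realLe (.sub (.reg 3) (.reg 0)) (.cell 7 (.reg 1)))
        (.storeReal 7 (.reg 1) (.sub (.reg 3) (.reg 0))) .skip)
    .skip

/-- Computes the forbidden region of job `nat 1`. -/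
def regionRow : Program :=
  .storeReal 7 (.reg 1) (.cell 4 (.reg 1)) ;; forLoop 2 0 regionColumn

/-- Computes the left ends of the forbidden regions into real array `7`, from the release dates in
real array `4` and the deadlines in real array `5`. -/
def regionProgram : Program :=
  forLoop 1 0 (.storeReal 6 (.reg 1) (.add (.cell 5 (.reg 1)) (.reg 0))) ;;
  forLoop 1 0 regionRow

variable {u : ℕ → ℝ → ℝ} {σ : State} {n : ℕ}

theorem runs_retreatProgram {q : ℕ} (hq : σ.nat 1 = q) (hqn : q < n)
    (hR : ∀ i j, i ≤ j → j < n → σ.realArr 4 j ≤ σ.realArr 4 i) :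
    Runs u retreatProgram σ (n * 23 + 6) fun σ' =>
      IsGreatest {x | x ≤ σ.real 3 ∧ Allowed (σ.realArr 4) (σ.realArr 7) q x} (σ'.real 3) := by
  unfold retreatProgram
  apply Runs.mono
  · apply Runs.forLoop (N := q) (fun m σ' =>
      IsGreatest {x | x ≤ σ.real 3 ∧ Allowed (σ.realArr 4) (σ.realArr 7) m x} (σ'.real 3))
      rfl rfl (by decide)
    · exact hq
    · exact ⟨⟨le_rfl, fun i hi => by omega⟩, fun x hx => hx.1⟩
    · intro m hm σ' hf hm' hI
      have e4 : σ'.realArr 4 = σ.realArr 4 := hf.realArr 4 rfl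
      have e7 : σ'.realArr 7 = σ.realArr 7 := hf.realArr 7 rfl
      have key := isGreatest_allowed_succ (fun i hi => hR i m hi.le (by omega)) hI
      apply Runs.ite <;> intro h
      · simp only [BoolExpr.Holds, RealExpr.eval, NatExpr.eval, hm', e4, e7, not_le] at h
        rw [if_pos h] at key
        apply Runs.setReal
        simpa [RealExpr.eval, NatExpr.eval, hm', e7] using key
      · simp only [BoolExpr.Holds, RealExpr.eval, NatExpr.eval, hm', e4, e7, not_le] at h
        rw [if_neg h] at key
        exact Runs.skip key
    · exact fun σ' _ h => h
  · simp only [RealExpr.cost, NatExpr.cost, BoolExpr.cost]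
    have := Nat.mul_le_mul_right 20 hqn.le
    omega

theorem runs_regionColumn {q j : ℕ} (hq : σ.nat 1 = q) (hqn : q < n) (hj : σ.nat 2 = j)
    (hR : ∀ i j, i ≤ j → j < n → σ.realArr 4 j ≤ σ.realArr 4 i) :
    Runs u regionColumn σ (n * 23 + 60) fun σ' =>
      (∀ i ≠ q, σ'.realArr 7 i = σ.realArr 7 i) ∧ σ'.realArr 7 q ≤ σ.realArr 7 q ∧
      (∀ i ≠ j, σ'.realArr 6 i = σ.realArr 6 i) ∧
      (σ.realArr 5 q ≤ σ.realArr 5 j →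
        IsGreatest {x | x ≤ σ.realArr 6 j - σ.real 0 ∧
          Allowed (σ.realArr 4) (σ.realArr 7) q x} (σ'.realArr 6 j) ∧
        σ'.realArr 7 q ≤ σ'.realArr 6 j - σ.real 0) ∧
      (¬ σ.realArr 5 q ≤ σ.realArr 5 j → σ'.realArr 6 j = σ.realArr 6 j) ∧
      (σ'.realArr 7 q = σ.realArr 7 q ∨ σ.realArr 5 q ≤ σ.realArr 5 j ∧
        σ'.realArr 7 q = σ'.realArr 6 j - σ.real 0) := by
  unfold regionColumn
  apply Runs.mono
  · apply Runs.ite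
    · intro h
      apply Runs.step
      apply Runs.setReal
      apply Runs.seq
      · exact runs_retreatProgram (n := n) hq hqn hR
      intro σ' hf hI
      have e0 : σ'.real 0 = σ.real 0 := hf.real 0 rfl
      have e1 : σ'.nat 1 = q := (hf.nat 1 rfl).trans hq
      have e2 : σ'.nat 2 = j := (hf.nat 2 rfl).trans hj
      have e7 : σ'.realArr 7 = σ.realArr 7 := hf.realArr 7 rfl
      have e6 : σ'.realArr 6 = σ.realArr 6 := hf.realArr 6 rfl
      simp only [BoolExpr.Holds, RealExpr.eval, NatExpr.eval, hq, hj] at h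
      simp [RealExpr.eval, NatExpr.eval, hj] at hI
      apply Runs.step
      apply Runs.storeReal
      apply Runs.ite
      · intro h'
        apply Runs.storeReal
        simp [BoolExpr.Holds, RealExpr.eval, NatExpr.eval, e0, e1, e2, e7, e6, h] at h' ⊢
        exact ⟨fun i hi => by simp [hi], h', fun i hi => by simp [hi], hI⟩
      · intro h'
        apply Runs.skip
        simp [BoolExpr.Holds, RealExpr.eval, NatExpr.eval, e0, e1, e2, e7, e6, h] at h' ⊢
        exact ⟨fun i hi => by simp [hi], hI, by linarith⟩
    · intro h
      apply Runs.skip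
      simp only [BoolExpr.Holds, RealExpr.eval, NatExpr.eval, hq, hj] at h
      simp [h]
  · simp only [RealExpr.cost, NatExpr.cost, BoolExpr.cost]
    omega

theorem runs_regionRow {q : ℕ} (hn : σ.nat 0 = n) (hq : σ.nat 1 = q) (hqn : q < n)
    (hR : ∀ i j, i ≤ j → j < n → σ.realArr 4 j ≤ σ.realArr 4 i) :
    Runs u regionRow σ (n * (n * 23 + 68) + 12) fun σ' =>
      (∀ i ≠ q, σ'.realArr 7 i = σ.realArr 7 i) ∧
      (∀ j < n, σ.realArr 5 q ≤ σ.realArr 5 j →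
        IsGreatest {x | x ≤ σ.realArr 6 j - σ.real 0 ∧
          Allowed (σ.realArr 4) (σ.realArr 7) q x} (σ'.realArr 6 j) ∧
        σ'.realArr 7 q ≤ σ'.realArr 6 j - σ.real 0) ∧
      (∀ j < n, ¬ σ.realArr 5 q ≤ σ.realArr 5 j → σ'.realArr 6 j = σ.realArr 6 j) ∧
      (σ'.realArr 7 q = σ.realArr 4 q ∨ ∃ j < n, σ.realArr 5 q ≤ σ.realArr 5 j ∧
        σ'.realArr 7 q = σ'.realArr 6 j - σ.real 0) := by
  unfold regionRow
  apply Runs.mono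
  · apply Runs.step
    apply Runs.storeReal
    apply Runs.forLoop (N := n) (fun m σ' =>
      (∀ i ≠ q, σ'.realArr 7 i = σ.realArr 7 i) ∧
      (∀ j < m, σ.realArr 5 q ≤ σ.realArr 5 j →
        IsGreatest {x | x ≤ σ.realArr 6 j - σ.real 0 ∧
          Allowed (σ.realArr 4) (σ.realArr 7) q x} (σ'.realArr 6 j) ∧
        σ'.realArr 7 q ≤ σ'.realArr 6 j - σ.real 0) ∧
      (∀ j < m, ¬ σ.realArr 5 q ≤ σ.realArr 5 j → σ'.realArr 6 j = σ.realArr 6 j) ∧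
      (∀ j, m ≤ j → σ'.realArr 6 j = σ.realArr 6 j) ∧
      (σ'.realArr 7 q = σ.realArr 4 q ∨ ∃ j < m, σ.realArr 5 q ≤ σ.realArr 5 j ∧
        σ'.realArr 7 q = σ'.realArr 6 j - σ.real 0)) rfl rfl (by decide)
    · exact hn
    · simp +contextual [RealExpr.eval, NatExpr.eval, hq, Function.update_of_ne]
    · rintro j hj σ₁ hf hj₁ ⟨h1, h2, h3, h4, h5⟩
      have e0 : σ₁.real 0 = σ.real 0 := hf.real 0 rfl
      have e1 : σ₁.nat 1 = q := (hf.nat 1 rfl).trans hq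
      have e4 : σ₁.realArr 4 = σ.realArr 4 := hf.realArr 4 rfl
      have e5 : σ₁.realArr 5 = σ.realArr 5 := hf.realArr 5 rfl
      have hA : ∀ x, Allowed (σ.realArr 4) (σ₁.realArr 7) q x ↔
          Allowed (σ.realArr 4) (σ.realArr 7) q x := fun x =>
        Allowed.congr fun i hi => h1 i hi.ne
      refine (runs_regionColumn (n := n) e1 hqn hj₁ (by rwa [e4])).imp ?_
      rintro σ₂ - ⟨g1, g2, g3, g4, g5, g6⟩
      simp only [e0, e4, e5, hA, h4 j le_rfl] at g1 g2 g3 g4 g5 g6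
      refine ⟨fun i hi => (g1 i hi).trans (h1 i hi), fun i hi hD => ?_, fun i hi hD => ?_,
        fun i hi => (g3 i (by omega)).trans (h4 i (by omega)), ?_⟩
      · rcases Nat.lt_succ_iff_lt_or_eq.1 hi with h | rfl
        · simp only [State.setNat_realArr, g3 i h.ne]
          exact ⟨(h2 i h hD).1, g2.trans (h2 i h hD).2⟩
        · exact g4 hD
      · rcases Nat.lt_succ_iff_lt_or_eq.1 hi with h | rfl
        · exact (g3 i h.ne).trans (h3 i h hD)
        · exact g5 hD
      · rcases g6 with g6 | g6
        · simp only [State.setNat_realArr, g6]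
          rcases h5 with h5 | ⟨i, hi, hD, h5⟩
          · exact Or.inl h5
          · exact Or.inr ⟨i, by omega, hD, by rw [h5, g3 i hi.ne]⟩
        · exact Or.inr ⟨j, by omega, g6⟩
    · rintro σ' - ⟨h1, h2, h3, -, h5⟩
      exact ⟨h1, h2, h3, h5⟩
  · simp only [RealExpr.cost, NatExpr.cost]
    ring_nf
    omega

theorem runs_regionProgram (hn : σ.nat 0 = n)
    (hR : ∀ i j, i ≤ j → j < n → σ.realArr 4 j ≤ σ.realArr 4 i) :
    Runs u regionProgram σ (n * (n * (n * 23 + 68) + 34) + 12) fun σ' =>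
      ∃ c, IsForbidden n n (σ.real 0) (σ.realArr 4) (σ.realArr 5) (σ'.realArr 7) c := by
  unfold regionProgram
  apply Runs.mono
  · apply Runs.seq
    · apply Runs.forLoop (N := n) (fun m σ' => ∀ j < m,
        σ'.realArr 6 j = σ.realArr 5 j + σ.real 0) rfl rfl (by decide) hn
      · intro j hj; omega
      · intro j hj σ' hf hj' hI
        have e0 : σ'.real 0 = σ.real 0 := hf.real 0 rfl
        have e5 : σ'.realArr 5 = σ.realArr 5 := hf.realArr 5 rfl
        apply Runs.storeReal
        intro i hi
        rcases Nat.lt_succ_iff_lt_or_eq.1 hi with h | rfl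
        · simpa [NatExpr.eval, hj', Function.update_of_ne h.ne] using hI i h
        · simp [NatExpr.eval, RealExpr.eval, hj', e0, e5]
      · exact fun σ' _ h => h
    · intro σ₁ hf₁ h₁
      apply Runs.forLoop (N := n) (fun m σ' => ∃ c,
        IsForbidden n m (σ.real 0) (σ.realArr 4) (σ.realArr 5) (σ'.realArr 7) c ∧
        ∀ j < n, σ'.realArr 6 j = c m j) rfl rfl (by decide)
      · exact (hf₁.nat 0 rfl).trans hn
      · refine ⟨fun _ j => σ₁.realArr 6 j, ⟨h₁, ?_, ?_, ?_, ?_⟩, fun j hj => rfl⟩ <;>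
          · intro q hq; omega
      · rintro q hq σ₂ hf₂ hq₂ ⟨c, hc, hC⟩
        have e0 : σ₂.real 0 = σ.real 0 := (hf₂.real 0 rfl).trans (hf₁.real 0 rfl)
        have en : σ₂.nat 0 = n := (hf₂.nat 0 rfl).trans ((hf₁.nat 0 rfl).trans hn)
        have e4 : σ₂.realArr 4 = σ.realArr 4 := (hf₂.realArr 4 rfl).trans (hf₁.realArr 4 rfl)
        have e5 : σ₂.realArr 5 = σ.realArr 5 := (hf₂.realArr 5 rfl).trans (hf₁.realArr 5 rfl)
        refine (runs_regionRow en hq₂ hq (by rwa [e4])).imp ?_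
        rintro σ₃ - ⟨g1, g2, g3, g4⟩
        simp only [e0, e4, e5] at g2 g3 g4
        refine ⟨_, hc.succ (C := σ₃.realArr 6) (fun i hi => g1 i hi.ne) (fun j hj hD => ?_)
          (fun j hj hD => ?_) g4, fun j hj => by simp⟩
        · rw [← hC j hj]; exact g2 j hj hD
        · rw [← hC j hj]; exact g3 j hj hD
      · rintro σ' - ⟨c, hc, -⟩
        exact ⟨c, hc⟩
  · simp only [RealExpr.cost, NatExpr.cost]
    ring_nf
    omega

end FairScheduling

namespace FairScheduling

open Program

/-! ### The program for the greedy schedule -/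

/-- One step of the search for the first allowed time from `b` on: since the right ends `R i`
decrease, leaving the interval `(L e, R e)` to the right cannot lead into a later one. -/
theorem isLeast_allowed_succ {R L : ℕ → ℝ} {n m e : ℕ} {b x : ℝ} (he : e + (m + 1) = n)
    (hR : ∀ i, e ≤ i → i < n → R i ≤ R e)
    (h : IsLeast {y | b ≤ y ∧ ∀ i < n, n ≤ i + m → ¬ (L i < y ∧ y < R i)} x) :
    IsLeast {y | b ≤ y ∧ ∀ i < n, n ≤ i + (m + 1) → ¬ (L i < y ∧ y < R i)}
      (if L e < x ∧ x < R e then R e else x) := by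
  obtain ⟨⟨hxb, hx⟩, hlb⟩ := h
  have hlb' : ∀ y, b ≤ y → (∀ i < n, n ≤ i + m → ¬ (L i < y ∧ y < R i)) → x ≤ y :=
    fun y h h' => hlb ⟨h, h'⟩
  split_ifs with hc
  · refine ⟨⟨by linarith [hc.2], fun i hi him => ?_⟩, fun y hy => ?_⟩
    · have := hR i (by omega) hi
      rintro ⟨-, h⟩
      linarith
    · have h1 := hlb' y hy.1 fun i hi him => hy.2 i hi (by omega)
      have h2 := hy.2 e (by omega) (by omega)
      by_contra! h3
      exact h2 ⟨by linarith, h3⟩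
  · refine ⟨⟨hxb, fun i hi him => ?_⟩, fun y hy => hlb' y hy.1 fun i hi him =>
      hy.2 i hi (by omega)⟩
    by_cases h : n ≤ i + m
    · exact hx i hi h
    · obtain rfl : i = e := by omega
      exact hc

theorem IsGreedy.succ {n m : ℕ} {p : ℝ} {R D L t t' : ℕ → ℝ} {J J' : ℕ → ℕ}
    (h : IsGreedy n m p R D L J t) (hJ : ∀ k < m, J' k = J k) (ht : ∀ k < m, t' k = t k)
    (hlt : J' m < n) (hinj : ∀ l < m, J l ≠ J' m)
    (hleast : IsLeast {x | 0 ≤ x ∧ (∀ l, m = l + 1 → t l + p ≤ x) ∧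
      (∃ q < n, (∀ l < m, J l ≠ q) ∧ R q ≤ x) ∧ Allowed R L n x} (t' m))
    (hrel : R (J' m) ≤ t' m)
    (hear : ∀ q < n, (∀ l < m, J l ≠ q) → R q ≤ t' m → D (J' m) ≤ D q) :
    IsGreedy n (m + 1) p R D L J' t' := by
  have hall : ∀ k ≤ m, ∀ q, (∀ l < k, J' l ≠ q) ↔ ∀ l < k, J l ≠ q := fun k hk q =>
    forall₂_congr fun l hl => by rw [hJ l (by omega)]
  have hprev : ∀ k ≤ m, ∀ x, (∀ l, k = l + 1 → t' l + p ≤ x) ↔ ∀ l, k = l + 1 → t l + p ≤ x :=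
    fun k hk x => forall₂_congr fun l hl => by rw [ht l (by omega)]
  refine ⟨fun k hk => ?_, fun k hk => ?_, fun k hk => ?_, fun k hk => ?_, fun k hk => ?_⟩ <;>
  rcases Nat.lt_succ_iff_lt_or_eq.1 hk with hk' | rfl
  · simpa [hJ k hk'] using h.lt k hk'
  · exact hlt
  · rw [hall k hk'.le, hJ k hk']; exact h.inj k hk'
  · rwa [hall k le_rfl]
  · simp only [hall k hk'.le, hprev k hk'.le, ht k hk']; exact h.least k hk'
  · simpa only [hall k le_rfl, hprev k le_rfl] using hleast
  · simpa [hJ k hk', ht k hk'] using h.release k hk'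
  · exact hrel
  · simp only [hall k hk'.le, hJ k hk', ht k hk']; exact h.earliest k hk'
  · simpa only [hall k le_rfl] using hear

/-- Puts into `nat 16` the last unscheduled job, which has the earliest release date. -/
def lastProgram : Program :=
  forLoop 2 0 (.ite (.natLe (.cell 1 (.reg 2)) (.const 0)) (.setNat 16 (.reg 2)) .skip)

/-- Moves `real 3` to the first time from `real 3` on that lies outside all forbidden regions. -/
def advanceProgram : Program :=
  forLoop 2 0 (.ite (.and
      (.not (.realLe (.reg 3) (.cell 7 (.sub (.sub (.reg 0) (.const 1)) (.reg 2)))))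
      (.not (.realLe (.cell 4 (.sub (.sub (.reg 0) (.const 1)) (.reg 2))) (.reg 3))))
    (.setReal 3 (.cell 4 (.sub (.sub (.reg 0) (.const 1)) (.reg 2)))) .skip)

/-- Replaces the available job `nat 16` by an available job with the earliest deadline. -/
def selectProgram : Program :=
  forLoop 2 0 (.ite (.and (.natLe (.cell 1 (.reg 2)) (.const 0))
      (.and (.realLe (.cell 4 (.reg 2)) (.reg 3))
        (.realLe (.cell 5 (.reg 2)) (.cell 5 (.reg 16)))))
    (.setNat 16 (.reg 2)) .skip)

/-- Schedules the next job. -/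
def greedyStep : Program :=
  lastProgram ;;
  .ite (.realLe (.reg 3) (.cell 4 (.reg 16))) (.setReal 3 (.cell 4 (.reg 16))) .skip ;;
  advanceProgram ;;
  selectProgram ;;
  .storeNat 2 (.reg 1) (.reg 16) ;;
  .storeReal 8 (.reg 1) (.reg 3) ;;
  .storeNat 1 (.reg 16) (.const 1) ;;
  .setReal 3 (.add (.reg 3) (.reg 0))

/-- Computes the greedy schedule: the order of the jobs in natural array `2`, the starting times in
real array `8`. The scheduled jobs are marked in natural array `1`. -/
def greedyProgram : Program :=
  forLoop 1 0 (.storeNat 1 (.reg 1) (.const 0)) ;;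
  .setReal 3 (.const 0) ;;
  forLoop 1 0 greedyStep

variable {u : ℕ → ℝ → ℝ} {σ : State} {n : ℕ}

theorem runs_lastProgram (hn : σ.nat 0 = n) :
    Runs u lastProgram σ (n * 15 + 6) fun σ' => ∀ q < n, σ.natArr 1 q = 0 →
      q ≤ σ'.nat 16 ∧ σ'.nat 16 < n ∧ σ.natArr 1 (σ'.nat 16) = 0 := by
  unfold lastProgram
  apply Runs.mono
  · apply Runs.forLoop (N := n) (fun m σ' => ∀ q < m, σ.natArr 1 q = 0 →
      q ≤ σ'.nat 16 ∧ σ'.nat 16 < n ∧ σ.natArr 1 (σ'.nat 16) = 0) rfl rfl (by decide) hn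
    · intro q hq; omega
    · intro k hk σ' hf hk' hI
      have e1 : σ'.natArr 1 = σ.natArr 1 := hf.natArr 1 rfl
      apply Runs.ite
      · intro h
        simp [BoolExpr.Holds, NatExpr.eval, e1, hk'] at h
        apply Runs.setNat
        intro q hq _
        simp [NatExpr.eval, hk', hk, h]
        omega
      · intro h
        simp [BoolExpr.Holds, NatExpr.eval, e1, hk'] at h
        apply Runs.skip
        intro q hq hq'
        rcases Nat.lt_succ_iff_lt_or_eq.1 hq with h' | rfl
        · simpa using hI q h' hq'
        · exact absurd hq' h
    · exact fun σ' _ h => h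
  · simp only [NatExpr.cost, BoolExpr.cost]
    omega

theorem runs_advanceProgram (hn : σ.nat 0 = n)
    (hR : ∀ i j, i ≤ j → j < n → σ.realArr 4 j ≤ σ.realArr 4 i) :
    Runs u advanceProgram σ (n * 40 + 6) fun σ' =>
      IsLeast {x | σ.real 3 ≤ x ∧ Allowed (σ.realArr 4) (σ.realArr 7) n x} (σ'.real 3) := by
  unfold advanceProgram
  apply Runs.mono
  · apply Runs.forLoop (N := n) (fun m σ' =>
      IsLeast {y | σ.real 3 ≤ y ∧ ∀ i < n, n ≤ i + m →
        ¬ (σ.realArr 7 i < y ∧ y < σ.realArr 4 i)} (σ'.real 3)) rfl rfl (by decide) hn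
    · exact ⟨⟨le_rfl, fun i hi => by omega⟩, fun x hx => hx.1⟩
    · intro m hm σ' hf hm' hI
      have e4 : σ'.realArr 4 = σ.realArr 4 := hf.realArr 4 rfl
      have e7 : σ'.realArr 7 = σ.realArr 7 := hf.realArr 7 rfl
      have e0 : σ'.nat 0 = n := (hf.nat 0 rfl).trans hn
      have key := isLeast_allowed_succ (e := n - 1 - m) (by omega) (fun i hi => hR _ i hi) hI
      apply Runs.ite
      · intro h
        simp only [BoolExpr.Holds, RealExpr.eval, NatExpr.eval, hm', e4, e7, e0, not_le] at h
        rw [if_pos h] at key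
        apply Runs.setReal
        simpa only [RealExpr.eval, NatExpr.eval, hm', e4, e0, State.setReal_real,
          State.setNat_real, if_true] using key
      · intro h
        simp only [BoolExpr.Holds, RealExpr.eval, NatExpr.eval, hm', e4, e7, e0, not_le] at h
        rw [if_neg h] at key
        exact Runs.skip key
    · intro σ' _ h
      simpa [Allowed] using h
  · simp only [RealExpr.cost, NatExpr.cost, BoolExpr.cost]
    omega

theorem runs_selectProgram (hn : σ.nat 0 = n) (h16 : σ.nat 16 < n)
    (h16' : σ.natArr 1 (σ.nat 16) = 0) (h16R : σ.realArr 4 (σ.nat 16) ≤ σ.real 3) :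
    Runs u selectProgram σ (n * 30 + 6) fun σ' =>
      σ'.nat 16 < n ∧ σ.natArr 1 (σ'.nat 16) = 0 ∧ σ.realArr 4 (σ'.nat 16) ≤ σ.real 3 ∧
      ∀ q < n, σ.natArr 1 q = 0 → σ.realArr 4 q ≤ σ.real 3 →
        σ.realArr 5 (σ'.nat 16) ≤ σ.realArr 5 q := by
  unfold selectProgram
  apply Runs.mono
  · apply Runs.forLoop (N := n) (fun m σ' =>
      σ'.nat 16 < n ∧ σ.natArr 1 (σ'.nat 16) = 0 ∧ σ.realArr 4 (σ'.nat 16) ≤ σ.real 3 ∧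
      ∀ q < m, σ.natArr 1 q = 0 → σ.realArr 4 q ≤ σ.real 3 →
        σ.realArr 5 (σ'.nat 16) ≤ σ.realArr 5 q) rfl rfl (by decide) hn
    · exact ⟨by simpa using h16, by simpa using h16', by simpa using h16R, fun q hq => by omega⟩
    · rintro k hk σ' hf hk' ⟨h1, h2, h3, h4⟩
      have e1 : σ'.natArr 1 = σ.natArr 1 := hf.natArr 1 rfl
      have e3 : σ'.real 3 = σ.real 3 := hf.real 3 rfl
      have e4 : σ'.realArr 4 = σ.realArr 4 := hf.realArr 4 rfl
      have e5 : σ'.realArr 5 = σ.realArr 5 := hf.realArr 5 rfl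
      apply Runs.ite
      · intro h
        simp [BoolExpr.Holds, RealExpr.eval, NatExpr.eval, e1, e3, e4, e5, hk'] at h
        apply Runs.setNat
        simp [NatExpr.eval, hk', hk, h]
        intro q hq hq1 hq2
        rcases hq.lt_or_eq with h' | rfl
        · exact h.2.2.trans (h4 q h' hq1 hq2)
        · exact le_rfl
      · intro h
        simp [BoolExpr.Holds, RealExpr.eval, NatExpr.eval, e1, e3, e4, e5, hk'] at h
        apply Runs.skip
        refine ⟨by simpa using h1, by simpa using h2, by simpa using h3, fun q hq hq1 hq2 => ?_⟩
        rcases Nat.lt_succ_iff_lt_or_eq.1 hq with h' | rfl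
        · simpa using h4 q h' hq1 hq2
        · simpa using (h hq1 hq2).le
    · exact fun σ' _ h => h
  · simp only [RealExpr.cost, NatExpr.cost, BoolExpr.cost]
    omega

theorem exists_unscheduled {n m : ℕ} (hm : m < n) (J : ℕ → ℕ) :
    ∃ q < n, ∀ l < m, J l ≠ q := by
  have h : ((Finset.range m).image J).card < (Finset.range n).card := by
    refine Finset.card_image_le.trans_lt ?_
    simpa using hm
  obtain ⟨q, hq, hq'⟩ := Finset.exists_mem_notMem_of_card_lt_card h
  refine ⟨q, by simpa using hq, fun l hl h => hq' ?_⟩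
  exact Finset.mem_image.2 ⟨l, by simpa using hl, h⟩

/-- What is known after `m` jobs have been scheduled by the greedy rule. -/
structure GreedyState (n m : ℕ) (p : ℝ) (R D L : ℕ → ℝ) (σ : State) : Prop where
  greedy : IsGreedy n m p R D L (σ.natArr 2) (σ.realArr 8)
  marks : ∀ q < n, σ.natArr 1 q = 0 ↔ ∀ l < m, σ.natArr 2 l ≠ q
  nonneg : 0 ≤ σ.real 3
  zero : m = 0 → σ.real 3 = 0
  succ : ∀ l, m = l + 1 → σ.real 3 = σ.realArr 8 l + p

theorem runs_greedyStep {m : ℕ} {p : ℝ} {R D L : ℕ → ℝ} (hn : σ.nat 0 = n) (hm : σ.nat 1 = m)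
    (hmn : m < n) (hp : σ.real 0 = p) (hp0 : 0 ≤ p) (hR : σ.realArr 4 = R) (hD : σ.realArr 5 = D)
    (hL : σ.realArr 7 = L) (hanti : ∀ i j, i ≤ j → j < n → R j ≤ R i)
    (h : GreedyState n m p R D L σ) :
    Runs u greedyStep σ (n * 85 + 50) (GreedyState n (m + 1) p R D L) := by
  unfold greedyStep
  apply Runs.mono
  · apply Runs.seq
    · exact runs_lastProgram hn
    intro σ₁ f₁ h₁
    obtain ⟨q₀, hq₀, hq₀'⟩ := exists_unscheduled hmn (σ.natArr 2)
    obtain ⟨-, hs, hs'⟩ := h₁ q₀ hq₀ ((h.marks q₀ hq₀).2 hq₀')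
    -- the earliest possible start, before forbidden regions are taken into account
    apply Runs.seq (Q' := fun σ' => σ'.real 3 = max (σ.real 3) (R (σ₁.nat 16)))
    · have e3 : σ₁.real 3 = σ.real 3 := f₁.real 3 rfl
      have e4 : σ₁.realArr 4 = R := (f₁.realArr 4 rfl).trans hR
      apply Runs.ite
      · intro hc
        apply Runs.setReal
        simp [BoolExpr.Holds, RealExpr.eval, NatExpr.eval, e3, e4] at hc ⊢
        exact hc
      · intro hc
        apply Runs.skip
        simp [BoolExpr.Holds, RealExpr.eval, NatExpr.eval, e3, e4] at hc ⊢
        exact hc.le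
    intro σ₂ f₂ h₂
    have e16 : σ₂.nat 16 = σ₁.nat 16 := f₂.nat 16 rfl
    have en₂ : σ₂.nat 0 = n := (f₂.nat 0 rfl).trans ((f₁.nat 0 rfl).trans hn)
    have eR₂ : σ₂.realArr 4 = R := (f₂.realArr 4 rfl).trans ((f₁.realArr 4 rfl).trans hR)
    have eL₂ : σ₂.realArr 7 = L := (f₂.realArr 7 rfl).trans ((f₁.realArr 7 rfl).trans hL)
    apply Runs.seq
    · exact runs_advanceProgram en₂ (by rwa [eR₂])
    intro σ₃ f₃ h₃
    rw [h₂, eR₂, eL₂] at h₃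
    have e16' : σ₃.nat 16 = σ₁.nat 16 := (f₃.nat 16 rfl).trans e16
    have en₃ : σ₃.nat 0 = n := (f₃.nat 0 rfl).trans en₂
    have eR₃ : σ₃.realArr 4 = R := (f₃.realArr 4 rfl).trans eR₂
    have eD₃ : σ₃.realArr 5 = D :=
      (f₃.realArr 5 rfl).trans ((f₂.realArr 5 rfl).trans ((f₁.realArr 5 rfl).trans hD))
    have em₃ : σ₃.natArr 1 = σ.natArr 1 :=
      (f₃.natArr 1 rfl).trans ((f₂.natArr 1 rfl).trans (f₁.natArr 1 rfl))
    apply Runs.seq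
    · refine runs_selectProgram en₃ (by rwa [e16']) (by rwa [e16', em₃]) ?_
      rw [e16', eR₃]
      exact (le_max_right _ _).trans h₃.1.1
    rintro σ₄ f₄ ⟨g1, g2, g3, g4⟩
    rw [em₃] at g2
    rw [eR₃] at g3
    simp only [em₃, eR₃, eD₃] at g4
    have e3 : σ₄.real 3 = σ₃.real 3 := f₄.real 3 rfl
    have e0 : σ₄.real 0 = p := (f₄.real 0 rfl).trans ((f₃.real 0 rfl).trans
      ((f₂.real 0 rfl).trans ((f₁.real 0 rfl).trans hp)))
    have e1 : σ₄.nat 1 = m := (f₄.nat 1 rfl).trans ((f₃.nat 1 rfl).trans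
      ((f₂.nat 1 rfl).trans ((f₁.nat 1 rfl).trans hm)))
    have ea1 : σ₄.natArr 1 = σ.natArr 1 := (f₄.natArr 1 rfl).trans em₃
    have ea2 : σ₄.natArr 2 = σ.natArr 2 := (f₄.natArr 2 rfl).trans ((f₃.natArr 2 rfl).trans
      ((f₂.natArr 2 rfl).trans (f₁.natArr 2 rfl)))
    have ea8 : σ₄.realArr 8 = σ.realArr 8 := (f₄.realArr 8 rfl).trans ((f₃.realArr 8 rfl).trans
      ((f₂.realArr 8 rfl).trans (f₁.realArr 8 rfl)))
    apply Runs.step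
    apply Runs.storeNat
    apply Runs.step
    apply Runs.storeReal
    apply Runs.step
    apply Runs.storeNat
    apply Runs.setReal
    have h0 : 0 ≤ σ₃.real 3 := h.nonneg.trans ((le_max_left _ _).trans h₃.1.1)
    refine ⟨?_, fun q hq => ?_, ?_, fun h => by omega, fun l hl => ?_⟩
    · refine h.greedy.succ (fun k hk => ?_) (fun k hk => ?_) ?_ ?_ ?_ ?_ ?_
      · simp [NatExpr.eval, e1, ea2, Function.update_of_ne hk.ne]
      · simp [NatExpr.eval, e1, ea8, Function.update_of_ne hk.ne]
      · simpa [NatExpr.eval, e1] using g1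
      · simpa [NatExpr.eval, e1] using (h.marks _ g1).1 g2
      · simp only [NatExpr.eval, RealExpr.eval, e1, e3, State.setReal_realArr,
          State.storeNat_realArr, State.storeReal_realArr, if_true, State.storeNat_real,
          State.storeNat_nat, Function.update_self]
        refine ⟨⟨h0, fun l hl => ?_, ⟨σ₁.nat 16, hs, (h.marks _ hs).1 hs',
          (le_max_right _ _).trans h₃.1.1⟩, h₃.1.2⟩, fun x hx => h₃.2 ⟨max_le ?_ ?_, hx.2.2.2⟩⟩
        · rw [← h.succ l hl]
          exact (le_max_left _ _).trans h₃.1.1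
        · rcases Nat.eq_zero_or_eq_succ_pred m with hm0 | hm1
          · rw [h.zero hm0]; exact hx.1
          · rw [h.succ _ hm1]; exact hx.2.1 _ hm1
        · obtain ⟨q, hq, hq', hqx⟩ := hx.2.2.1
          exact (hanti q _ (h₁ q hq ((h.marks q hq).2 hq')).1 hs).trans hqx
      · simpa [NatExpr.eval, RealExpr.eval, e1, e3] using g3
      · intro q hq hq' hqt
        simp [NatExpr.eval, RealExpr.eval, e1, e3] at hqt ⊢
        exact g4 q hq ((h.marks q hq).2 hq') hqt
    · simp only [NatExpr.eval, State.setReal_natArr, State.storeNat_natArr, State.storeReal_natArr,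
        State.storeReal_nat, State.storeNat_nat, e1, ea1, ea2]
      simp only [if_true, if_neg (by decide : ¬ (1 : ℕ) = 2), if_neg (by decide : ¬ (2 : ℕ) = 1)]
      by_cases hqs : q = σ₄.nat 16
      · subst hqs
        simp only [Function.update_self, one_ne_zero, false_iff, not_forall]
        exact ⟨m, by omega, by simp⟩
      · rw [Function.update_of_ne hqs, h.marks q hq]
        constructor
        · intro hq' l hl
          rcases Nat.lt_succ_iff_lt_or_eq.1 hl with h' | rfl
          · rw [Function.update_of_ne h'.ne]; exact hq' l h'
          · rw [Function.update_self]; exact Ne.symm hqs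
        · intro hq' l hl
          have := hq' l (by omega)
          rwa [Function.update_of_ne hl.ne] at this
    · simp [RealExpr.eval, e3, e0]
      linarith
    · obtain rfl : m = l := by omega
      simp [RealExpr.eval, NatExpr.eval, e3, e0, e1]
  · simp only [RealExpr.cost, NatExpr.cost, BoolExpr.cost]
    omega

theorem runs_greedyProgram (hn : σ.nat 0 = n) (hp0 : 0 ≤ σ.real 0)
    (hanti : ∀ i j, i ≤ j → j < n → σ.realArr 4 j ≤ σ.realArr 4 i) :
    Runs u greedyProgram σ (n * (n * 85 + 69) + 14) fun σ' =>
      IsGreedy n n (σ.real 0) (σ.realArr 4) (σ.realArr 5) (σ.realArr 7)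
        (σ'.natArr 2) (σ'.realArr 8) := by
  unfold greedyProgram
  apply Runs.mono
  · apply Runs.seq
    · apply Runs.forLoop (N := n) (fun m σ' => ∀ j < m, σ'.natArr 1 j = 0) rfl rfl (by decide) hn
      · intro j hj; omega
      · intro j hj σ' hf hj' hI
        apply Runs.storeNat
        intro i hi
        rcases Nat.lt_succ_iff_lt_or_eq.1 hi with h | rfl
        · simpa [NatExpr.eval, hj', Function.update_of_ne h.ne] using hI i h
        · simp [NatExpr.eval, hj']
      · exact fun σ' _ h => h
    · intro σ₁ f₁ h₁
      apply Runs.step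
      apply Runs.setReal
      apply Runs.forLoop (N := n)
        (fun m σ' => GreedyState n m (σ.real 0) (σ.realArr 4) (σ.realArr 5) (σ.realArr 7) σ')
        rfl rfl (by decide)
      · exact (f₁.nat 0 rfl).trans hn
      · refine ⟨⟨?_, ?_, ?_, ?_, ?_⟩, fun q hq => ?_, ?_, fun _ => ?_, fun l hl => by omega⟩
        · intro k hk; omega
        · intro k hk; omega
        · intro k hk; omega
        · intro k hk; omega
        · intro k hk; omega
        · simpa using h₁ q hq
        · simp [RealExpr.eval]
        · simp [RealExpr.eval]
      · intro m hm σ₂ f₂ hm' hI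
        refine (runs_greedyStep ((f₂.nat 0 rfl).trans ((f₁.nat 0 rfl).trans hn)) hm' hm
          ((f₂.real 0 rfl).trans (f₁.real 0 rfl)) hp0 ((f₂.realArr 4 rfl).trans (f₁.realArr 4 rfl))
          ((f₂.realArr 5 rfl).trans (f₁.realArr 5 rfl))
          ((f₂.realArr 7 rfl).trans (f₁.realArr 7 rfl)) hanti hI).imp ?_
        intro σ₃ _ h
        exact ⟨h.greedy, h.marks, h.nonneg, h.zero, h.succ⟩
      · exact fun σ' _ h => h.greedy
  · simp only [RealExpr.cost, NatExpr.cost]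
    ring_nf
    omega

end FairScheduling

namespace FairScheduling

open Program

/-! ### The decision program -/

/-- Starts job `natArr 2 (nat 1)` as early as possible, records its starting time under its original
number, and clears the flag `nat 15` if its utility falls below `real 4`. -/
def outputStep : Program :=
  .setNat 16 (.cell 2 (.reg 1)) ;;
  .ite (.realLe (.reg 3) (.cell 4 (.reg 16))) (.setReal 3 (.cell 4 (.reg 16))) .skip ;;
  .storeReal 1 (.cell 0 (.reg 16)) (.reg 3) ;;
  .setReal 3 (.add (.reg 3) (.reg 0)) ;;
  .ite (.realLe (.reg 4) (.util (.cell 0 (.reg 16)) (.reg 3))) .skip (.setNat 15 (.const 0))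

/-- Writes the semi-active schedule with the job order of natural array `2` into real array `1`; the
flag `nat 15` tells whether all utilities are at least `real 4`. -/
def outputProgram : Program :=
  .setReal 3 (.const 0) ;; .setNat 15 (.const 1) ;; forLoop 1 0 outputStep

/-- Tries to find a schedule whose minimum utility is at least `real 4`. -/
def decideProgram : Program :=
  deadlineProgram ;; regionProgram ;; greedyProgram ;; outputProgram

section

variable {u : ℕ → ℝ → ℝ} {σ : State} {n : ℕ}

theorem runs_outputProgram {π : ℕ → ℕ} {ρ : ℕ → ℝ} (hn : σ.nat 0 = n)
    (hπ : ∀ k < n, σ.natArr 0 (σ.natArr 2 k) = π k) (hρ : ∀ k < n, σ.realArr 4 (σ.natArr 2 k) = ρ k)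
    (hinj : ∀ k < n, ∀ l < n, π k = π l → k = l) :
    Runs u outputProgram σ (n * 50 + 20) fun σ' =>
      (∀ k < n, σ'.realArr 1 (π k) = max (freeTime (σ.real 0) ρ k) (ρ k)) ∧
      (1 ≤ σ'.nat 15 ↔ ∀ k < n,
        σ.real 4 ≤ u (π k) (max (freeTime (σ.real 0) ρ k) (ρ k) + σ.real 0)) := by
  unfold outputProgram
  apply Runs.mono
  · apply Runs.step
    apply Runs.setReal
    apply Runs.step
    apply Runs.setNat
    apply Runs.forLoop (N := n) (fun m σ' =>
      σ'.real 3 = freeTime (σ.real 0) ρ m ∧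
      (∀ k < m, σ'.realArr 1 (π k) = max (freeTime (σ.real 0) ρ k) (ρ k)) ∧
      (1 ≤ σ'.nat 15 ↔ ∀ k < m,
        σ.real 4 ≤ u (π k) (max (freeTime (σ.real 0) ρ k) (ρ k) + σ.real 0)))
      rfl rfl (by decide)
    · exact hn
    · simp [freeTime, RealExpr.eval, NatExpr.eval]
    · rintro k hk σ₁ f₁ hk₁ ⟨h1, h2, h3⟩
      have e0 : σ₁.real 0 = σ.real 0 := f₁.real 0 rfl
      have e4 : σ₁.real 4 = σ.real 4 := f₁.real 4 rfl
      have ea0 : σ₁.natArr 0 = σ.natArr 0 := f₁.natArr 0 rfl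
      have ea2 : σ₁.natArr 2 = σ.natArr 2 := f₁.natArr 2 rfl
      have ea4 : σ₁.realArr 4 = σ.realArr 4 := f₁.realArr 4 rfl
      unfold outputStep
      apply Runs.step
      apply Runs.setNat
      apply Runs.seq (Q' := fun σ' => σ'.real 3 = max (freeTime (σ.real 0) ρ k) (ρ k))
      · apply Runs.ite
        · intro hc
          apply Runs.setReal
          simp [BoolExpr.Holds, RealExpr.eval, NatExpr.eval, hk₁, ea2, ea4, hρ k hk, h1] at hc ⊢
          exact hc
        · intro hc
          apply Runs.skip
          simp [BoolExpr.Holds, RealExpr.eval, NatExpr.eval, hk₁, ea2, ea4, hρ k hk, h1] at hc ⊢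
          exact hc.le
      intro σ₂ f₂ h₂
      have g0 : σ₂.real 0 = σ.real 0 := (f₂.real 0 rfl).trans e0
      have g4 : σ₂.real 4 = σ.real 4 := (f₂.real 4 rfl).trans e4
      have ga0 : σ₂.natArr 0 = σ.natArr 0 := (f₂.natArr 0 rfl).trans ea0
      have ga1 : σ₂.realArr 1 = σ₁.realArr 1 := f₂.realArr 1 rfl
      have g16 : σ₂.nat 16 = σ.natArr 2 k := by
        rw [f₂.nat 16 rfl]; simp [NatExpr.eval, hk₁, ea2]
      have g15 : σ₂.nat 15 = σ₁.nat 15 := by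
        rw [f₂.nat 15 rfl]; simp
      have hstore : ∀ l < k, Function.update (σ₁.realArr 1) (π k)
          (max (freeTime (σ.real 0) ρ k) (ρ k)) (π l) = max (freeTime (σ.real 0) ρ l) (ρ l) := by
        intro l hl
        rw [Function.update_of_ne, h2 l hl]
        exact fun he => hl.ne (hinj l (by omega) k hk he)
      have hflag : ∀ Q : ℕ → Prop, (∀ l < k + 1, Q l) ↔ Q k ∧ ∀ l < k, Q l := fun Q =>
        ⟨fun h => ⟨h k (by omega), fun l hl => h l (by omega)⟩, fun h l hl => by
          rcases Nat.lt_succ_iff_lt_or_eq.1 hl with h' | rfl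
          · exact h.2 l h'
          · exact h.1⟩
      apply Runs.step
      apply Runs.storeReal
      apply Runs.step
      apply Runs.setReal
      apply Runs.ite
      · intro hc
        apply Runs.skip
        simp only [hflag]
        simp [BoolExpr.Holds, RealExpr.eval, NatExpr.eval, g0, g4, ga0, ga1, g16, g15, h₂, hπ k hk,
          freeTime] at hc ⊢
        exact ⟨hstore, by rw [h3]; simp [hc]⟩
      · intro hc
        apply Runs.setNat
        simp only [hflag]
        simp [BoolExpr.Holds, RealExpr.eval, NatExpr.eval, g0, g4, ga0, ga1, g16, h₂, hπ k hk,
          freeTime] at hc ⊢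
        exact ⟨hstore, fun h => by linarith⟩
    · rintro σ' - ⟨-, h⟩
      exact h
  · simp only [RealExpr.cost, NatExpr.cost, BoolExpr.cost]
    omega

end

variable {n : ℕ}

/-- The memory `σ` holds the instance `I`, with the jobs sorted by non-increasing release dates: the
`q`-th job in this order is `natArr 0 q`, and its release date is `realArr 4 q`. -/
structure Prepared (I : Problem n) (σ : State) : Prop where
  nat_zero : σ.nat 0 = n
  real_zero : σ.real 0 = I.p
  release : ∀ i (hi : i < n), σ.realArr 0 i = I.r ⟨i, hi⟩
  order_lt : ∀ q < n, σ.natArr 0 q < n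
  order_inj : ∀ q < n, ∀ q' < n, σ.natArr 0 q = σ.natArr 0 q' → q = q'
  sorted_eq : ∀ q < n, σ.realArr 4 q = σ.realArr 0 (σ.natArr 0 q)
  antitone : ∀ i j, i ≤ j → j < n → σ.realArr 4 j ≤ σ.realArr 4 i

theorem Prepared.frame {I : Problem n} {σ σ' : State} {P : Program} (h : Prepared I σ)
    (hf : Frame P σ σ') (h₁ : P.keepsNat 0 = true) (h₂ : P.keepsReal 0 = true)
    (h₃ : P.keepsRealArr 0 = true) (h₄ : P.keepsNatArr 0 = true) (h₅ : P.keepsRealArr 4 = true) :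
    Prepared I σ' := by
  have e₁ := hf.nat 0 h₁
  have e₂ := hf.real 0 h₂
  have e₃ := hf.realArr 0 h₃
  have e₄ := hf.natArr 0 h₄
  have e₅ := hf.realArr 4 h₅
  exact ⟨by rw [e₁]; exact h.nat_zero, by rw [e₂]; exact h.real_zero, by rw [e₃]; exact h.release,
    by rw [e₄]; exact h.order_lt, by rw [e₄]; exact h.order_inj,
    by rw [e₃, e₄, e₅]; exact h.sorted_eq, by rw [e₅]; exact h.antitone⟩

/-- Some schedule has a minimum utility of at least `v`. -/
def Problem.Attainable (I : Problem n) (v : ℝ) : Prop := ∃ s ∈ I.schedules, v ≤ I.uMin s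

theorem Problem.utility_of_lt (I : Problem n) {j : ℕ} (hj : j < n) : I.utility j = I.u ⟨j, hj⟩ := by
  funext t
  simp [Problem.utility, hj]

/-- A schedule with minimum utility at least `v` meets the corresponding deadlines. -/
theorem Prepared.meetsDeadlines {I : Problem n} {σ : State} (h : Prepared I σ) (hn : 0 < n)
    {v : ℝ} {D : ℕ → ℝ} (hD : ∀ q < n, ∀ i < n, ∀ k < n,
      v ≤ I.utility (σ.natArr 0 q) (σ.realArr 0 i + (k : ℕ) * I.p + I.p) →
        σ.realArr 0 i + k * I.p ≤ D q)
    {s : Fin n → ℝ} (hs : s ∈ I.schedules) (hv : v ≤ I.uMin s) :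
    MeetsDeadlines n I.p (σ.realArr 4) D
      (fun q => if hq : σ.natArr 0 q < n then s ⟨_, hq⟩ else 0) := by
  refine ⟨fun q hq => ?_, fun q hq => ?_, fun q hq q' hq' hne => ?_⟩
  · have hlt := h.order_lt q hq
    rw [dif_pos hlt, h.sorted_eq q hq, h.release _ hlt]
    exact hs.1.1 _
  · have hlt := h.order_lt q hq
    rw [dif_pos hlt]
    obtain ⟨i, k, hk, hik⟩ := Problem.exists_start_eq hs ⟨_, hlt⟩
    have := hD q hq i i.2 k hk
    rw [h.release i i.2, I.utility_of_lt hlt, ← hik] at this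
    rw [hik] at this ⊢
    refine this ?_
    rw [← hik]
    exact (I.le_uMin_iff hn).1 hv _
  · have hlt := h.order_lt q hq
    have hlt' := h.order_lt q' hq'
    simp only [dif_pos hlt, dif_pos hlt']
    exact hs.1.2 _ _ fun he => hne (h.order_inj q hq q' hq' (by simpa using he))

/-- The decision program is correct. If its flag is set, the schedule it returns shows that the value is
attainable; conversely, an attainable value can be attained by the greedy schedule. -/
theorem runs_decideProgram {I : Problem n} {σ : State} (hn : 0 < n) (h : Prepared I σ) :
    Runs I.utility decideProgram σ (500 * n ^ 3) fun σ' =>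
      (1 ≤ σ'.nat 15 ↔ I.Attainable (σ.real 4)) ∧
      (1 ≤ σ'.nat 15 → σ'.output n ∈ I.schedules ∧ σ.real 4 ≤ I.uMin (σ'.output n)) := by
  have hp := I.p_pos
  unfold decideProgram
  apply Runs.mono
  · apply Runs.seq
    · exact runs_deadlineProgram h.nat_zero
    intro σ₁ f₁ h₁
    have hP₁ : Prepared I σ₁ := h.frame f₁ rfl rfl rfl rfl rfl
    apply Runs.seq
    · exact runs_regionProgram hP₁.nat_zero hP₁.antitone
    rintro σ₂ f₂ ⟨c, hc⟩
    have hP₂ : Prepared I σ₂ := hP₁.frame f₂ rfl rfl rfl rfl rfl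
    apply Runs.seq
    · exact runs_greedyProgram hP₂.nat_zero (by rw [hP₂.real_zero]; exact hp.le) hP₂.antitone
    intro σ₃ f₃ ht
    have hP₃ : Prepared I σ₃ := hP₂.frame f₃ rfl rfl rfl rfl rfl
    have hinj : ∀ k < n, ∀ l < n,
        σ₃.natArr 0 (σ₃.natArr 2 k) = σ₃.natArr 0 (σ₃.natArr 2 l) → k = l := by
      intro k hk l hl hkl
      have := hP₃.order_inj _ (ht.lt k hk) _ (ht.lt l hl) hkl
      rcases lt_trichotomy k l with h | h | h
      · exact absurd this (ht.inj l hl k h)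
      · exact h
      · exact absurd this.symm (ht.inj k hk l h)
    refine (runs_outputProgram hP₃.nat_zero (fun k _ => rfl) (fun k _ => rfl) hinj).imp ?_
    rintro σ₄ - ⟨hout, hflag⟩
    have hπ : ∀ k < n, σ₃.natArr 0 (σ₃.natArr 2 k) < n := fun k hk => hP₃.order_lt _ (ht.lt k hk)
    have e4 : σ₃.real 4 = σ.real 4 :=
      (f₃.real 4 rfl).trans ((f₂.real 4 rfl).trans (f₁.real 4 rfl))
    rw [hP₃.real_zero] at hout hflag
    rw [e4] at hflag
    -- the flag is set if and only if the schedule has minimum utility at least `real 4`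
    have hmem : σ₄.output n ∈ I.schedules := by
      refine Problem.mem_schedules_of_order hπ hinj (fun k hk => ?_) fun k hk => hout k hk
      rw [hP₃.sorted_eq _ (ht.lt k hk), hP₃.release]
    have hflag' : 1 ≤ σ₄.nat 15 → σ.real 4 ≤ I.uMin (σ₄.output n) := by
      intro hf
      rw [I.le_uMin_iff hn]
      intro j
      obtain ⟨k, hk, hkj⟩ := exists_eq_of_injOn hπ hinj j.2
      have := hflag.1 hf k hk
      rw [← hout k hk, hkj, I.utility_of_lt j.2] at this
      exact this
    refine ⟨⟨fun hf => ⟨_, hmem, hflag' hf⟩, ?_⟩, fun hf => ⟨hmem, hflag' hf⟩⟩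
    rintro ⟨s, hs, hv⟩
    rw [h.real_zero] at h₁
    have e5 : σ₂.realArr 5 = σ₁.realArr 5 := f₂.realArr 5 rfl
    have eR₁ : σ₁.realArr 4 = σ.realArr 4 := f₁.realArr 4 rfl
    have eR₂ : σ₂.realArr 4 = σ.realArr 4 := (f₂.realArr 4 rfl).trans eR₁
    have eR₃ : σ₃.realArr 4 = σ.realArr 4 := (f₃.realArr 4 rfl).trans eR₂
    have eo₃ : σ₃.natArr 0 = σ.natArr 0 :=
      (f₃.natArr 0 rfl).trans ((f₂.natArr 0 rfl).trans (f₁.natArr 0 rfl))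
    have hX := h.meetsDeadlines hn (fun q hq => (h₁ q hq).1) hs hv
    rw [hP₁.real_zero, eR₁] at hc
    rw [hP₂.real_zero, eR₂, e5] at ht
    have hR0 : ∀ j < n, 0 ≤ σ.realArr 4 j := by
      intro j hj
      rw [h.sorted_eq j hj, h.release _ (h.order_lt j hj)]
      exact I.r_nonneg _
    rw [hflag]
    intro k hk
    have hJ := ht.lt k hk
    have hle : max (freeTime I.p (fun k => σ₃.realArr 4 (σ₃.natArr 2 k)) k)
        (σ₃.realArr 4 (σ₃.natArr 2 k)) ≤ σ₁.realArr 5 (σ₃.natArr 2 k) := by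
      rw [eR₃]
      exact (ht.freeTime_le hk).trans (ht.le_deadline hc hX hp h.antitone hR0 hk)
    have h0 : 0 ≤ max (freeTime I.p (fun k => σ₃.realArr 4 (σ₃.natArr 2 k)) k)
        (σ₃.realArr 4 (σ₃.natArr 2 k)) := by
      refine (hR0 _ hJ).trans ?_
      rw [eR₃]
      exact le_max_right _ _
    rcases (h₁ _ hJ).2 with hD | hD
    · linarith
    · refine hD.trans ?_
      rw [eo₃, I.utility_of_lt (h.order_lt _ hJ)]
      refine I.u_antitone _ ?_ ?_ ?_
      · simp only [Set.mem_Ici]; linarith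
      · simp only [Set.mem_Ici]; linarith
      · linarith
  · have h1 : n ≤ n ^ 3 := Nat.le_self_pow (by norm_num) n
    have h2 : n ^ 2 ≤ n ^ 3 := Nat.pow_le_pow_right hn (by norm_num)
    have h3 : 1 ≤ n ^ 3 := Nat.one_le_pow _ _ hn
    ring_nf
    omega

end FairScheduling

namespace FairScheduling

open Program

/-! ### Sorting the jobs by release dates -/

/-- Job `i` comes before job `j` in the order by non-increasing release dates `r`, with ties broken by
the job numbers. -/
def Precedes (r : ℕ → ℝ) (i j : ℕ) : Prop := r j ≤ r i ∧ ¬ (r i ≤ r j ∧ j ≤ i)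

theorem Precedes.irrefl {r : ℕ → ℝ} {i : ℕ} : ¬ Precedes r i i := by
  simp [Precedes]

theorem Precedes.trans {r : ℕ → ℝ} {i j k : ℕ} (h : Precedes r i j) (h' : Precedes r j k) :
    Precedes r i k := by
  refine ⟨h'.1.trans h.1, fun ⟨h1, h2⟩ => ?_⟩
  have h3 : r j ≤ r k := h.1.trans h1
  have h4 : r i ≤ r j := h1.trans h'.1
  have h5 := mt (fun h' => (⟨h4, h'⟩ : r i ≤ r j ∧ j ≤ i)) h.2
  have h6 := mt (fun h => (⟨h3, h⟩ : r j ≤ r k ∧ k ≤ j)) h'.2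
  omega

theorem precedes_or_precedes {r : ℕ → ℝ} {i j : ℕ} (h : i ≠ j) :
    Precedes r i j ∨ Precedes r j i := by
  rcases lt_trichotomy (r i) (r j) with h' | h' | h'
  · exact Or.inr ⟨h'.le, fun h => by linarith [h.1]⟩
  · rcases lt_or_gt_of_ne h with h | h
    · exact Or.inl ⟨h'.ge, fun h => by omega⟩
    · exact Or.inr ⟨h'.le, fun h => by omega⟩
  · exact Or.inl ⟨h'.le, fun h => by linarith [h.1]⟩

open Classical in
/-- The number of jobs, among the first `n`, that precede job `j`. -/
noncomputable def jobRank (r : ℕ → ℝ) (n j : ℕ) : ℕ :=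
  ((Finset.range n).filter fun i => Precedes r i j).card

theorem jobRank_succ_of_precedes {r : ℕ → ℝ} {n j : ℕ} (h : Precedes r n j) :
    jobRank r (n + 1) j = jobRank r n j + 1 := by
  classical
  rw [jobRank, Finset.range_add_one, Finset.filter_insert, if_pos h,
    Finset.card_insert_of_notMem (by simp)]
  rfl

theorem jobRank_succ_of_not_precedes {r : ℕ → ℝ} {n j : ℕ} (h : ¬ Precedes r n j) :
    jobRank r (n + 1) j = jobRank r n j := by
  classical
  rw [jobRank, Finset.range_add_one, Finset.filter_insert, if_neg h]
  rfl

theorem jobRank_lt_jobRank {r : ℕ → ℝ} {n i j : ℕ} (hi : i < n) (h : Precedes r i j) :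
    jobRank r n i < jobRank r n j := by
  classical
  refine Finset.card_lt_card (Finset.ssubset_iff_of_subset ?_ |>.2 ⟨i, ?_, ?_⟩)
  · intro a ha
    simp only [Finset.mem_filter] at ha ⊢
    exact ⟨ha.1, ha.2.trans h⟩
  · simpa [hi] using h
  · simp [Precedes.irrefl]

theorem jobRank_lt {r : ℕ → ℝ} {n j : ℕ} (hj : j < n) : jobRank r n j < n := by
  classical
  calc jobRank r n j < (Finset.range n).card := by
        refine Finset.card_lt_card (Finset.ssubset_iff_of_subset (Finset.filter_subset _ _) |>.2
          ⟨j, by simpa using hj, by simp [Precedes.irrefl]⟩)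
    _ = n := by simp

theorem jobRank_inj {r : ℕ → ℝ} {n i j : ℕ} (hi : i < n) (hj : j < n)
    (h : jobRank r n i = jobRank r n j) : i = j := by
  by_contra hne
  rcases precedes_or_precedes (r := r) hne with h' | h'
  · exact (jobRank_lt_jobRank hi h').ne h
  · exact (jobRank_lt_jobRank hj h').ne' h

/-- Computes the rank of job `nat 1` into `nat 5`. -/
def rankProgram : Program :=
  .setNat 5 (.const 0) ;;
  forLoop 2 0 (.ite (.and (.realLe (.cell 0 (.reg 1)) (.cell 0 (.reg 2)))
      (.not (.and (.realLe (.cell 0 (.reg 2)) (.cell 0 (.reg 1))) (.natLe (.reg 1) (.reg 2)))))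
    (.setNat 5 (.add (.reg 5) (.const 1))) .skip)

/-- Sorts the jobs by non-increasing release dates: each job is stored at its rank. -/
def sortJobsProgram : Program :=
  forLoop 1 0 (rankProgram ;; .storeNat 0 (.reg 5) (.reg 1) ;;
    .storeReal 4 (.reg 5) (.cell 0 (.reg 1)))

variable {u : ℕ → ℝ → ℝ} {σ : State} {n : ℕ}

theorem runs_rankProgram {j : ℕ} (hn : σ.nat 0 = n) (hj : σ.nat 1 = j) :
    Runs u rankProgram σ (n * 30 + 8) fun σ' => σ'.nat 5 = jobRank (σ.realArr 0) n j := by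
  unfold rankProgram
  apply Runs.mono
  · apply Runs.step
    apply Runs.setNat
    apply Runs.forLoop (N := n) (fun m σ' => σ'.nat 5 = jobRank (σ.realArr 0) m j)
      rfl rfl (by decide)
    · exact hn
    · simp [NatExpr.eval, jobRank]
    · intro m hm σ₁ f₁ hm₁ h₁
      have e1 : σ₁.nat 1 = j := (f₁.nat 1 rfl).trans hj
      have e0 : σ₁.realArr 0 = σ.realArr 0 := f₁.realArr 0 rfl
      apply Runs.ite
      · intro h
        simp only [BoolExpr.Holds, RealExpr.eval, NatExpr.eval, e1, e0, hm₁] at h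
        apply Runs.setNat
        simp [NatExpr.eval, h₁, jobRank_succ_of_precedes h]
      · intro h
        simp only [BoolExpr.Holds, RealExpr.eval, NatExpr.eval, e1, e0, hm₁] at h
        apply Runs.skip
        simp [h₁, jobRank_succ_of_not_precedes h]
    · exact fun σ' _ h => h
  · simp only [RealExpr.cost, NatExpr.cost, BoolExpr.cost]
    omega

theorem runs_sortJobsProgram {I : Problem n} (hn : σ.nat 0 = n) (hp : σ.real 0 = I.p)
    (hr : ∀ i (hi : i < n), σ.realArr 0 i = I.r ⟨i, hi⟩) :
    Runs u sortJobsProgram σ (n * (n * 30 + 30) + 6) (Prepared I) := by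
  unfold sortJobsProgram
  apply Runs.mono
  · apply Runs.forLoop (N := n) (fun m σ' => ∀ j < m,
      σ'.natArr 0 (jobRank (σ.realArr 0) n j) = j ∧
      σ'.realArr 4 (jobRank (σ.realArr 0) n j) = σ.realArr 0 j) rfl rfl (by decide) hn
    · intro j hj; omega
    · intro m hm σ₁ f₁ hm₁ hI
      apply Runs.seq
      · exact runs_rankProgram ((f₁.nat 0 rfl).trans hn) hm₁
      intro σ₂ f₂ h₂
      have e0 : σ₁.realArr 0 = σ.realArr 0 := f₁.realArr 0 rfl
      have e0' : σ₂.realArr 0 = σ.realArr 0 := (f₂.realArr 0 rfl).trans e0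
      have e1 : σ₂.nat 1 = m := (f₂.nat 1 rfl).trans hm₁
      have en : σ₂.natArr 0 = σ₁.natArr 0 := f₂.natArr 0 rfl
      have e4 : σ₂.realArr 4 = σ₁.realArr 4 := f₂.realArr 4 rfl
      rw [e0] at h₂
      apply Runs.step
      apply Runs.storeNat
      apply Runs.storeReal
      intro j hj
      simp only [NatExpr.eval, RealExpr.eval, State.setNat_natArr, State.setNat_realArr,
        State.storeReal_natArr, State.storeReal_realArr, State.storeNat_natArr,
        State.storeNat_realArr, State.storeNat_nat, if_true, h₂, e1, e0', en, e4]
      rcases Nat.lt_succ_iff_lt_or_eq.1 hj with h | rfl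
      · have hne : jobRank (σ.realArr 0) n j ≠ jobRank (σ.realArr 0) n m := fun he =>
          h.ne (jobRank_inj (by omega) hm he)
        rw [Function.update_of_ne hne, Function.update_of_ne hne]
        exact hI j h
      · simp
    · intro σ' f hI
      have e0 : σ'.realArr 0 = σ.realArr 0 := f.realArr 0 rfl
      have hex : ∀ q < n, ∃ j < n, jobRank (σ.realArr 0) n j = q := fun q hq =>
        exists_eq_of_injOn (fun k hk => jobRank_lt hk)
          (fun k hk l hl h => jobRank_inj hk hl h) hq
      refine ⟨(f.nat 0 rfl).trans hn, (f.real 0 rfl).trans hp, by rw [e0]; exact hr,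
        fun q hq => ?_, fun q hq q' hq' h => ?_, fun q hq => ?_, fun q q' hqq hq' => ?_⟩
      · obtain ⟨j, hj, rfl⟩ := hex q hq
        rwa [(hI j hj).1]
      · obtain ⟨j, hj, rfl⟩ := hex q hq
        obtain ⟨j', hj', rfl⟩ := hex q' hq'
        rw [(hI j hj).1, (hI j' hj').1] at h
        rw [h]
      · obtain ⟨j, hj, rfl⟩ := hex q hq
        rw [(hI j hj).1, (hI j hj).2, e0]
      · obtain ⟨j, hj, rfl⟩ := hex q (by omega)
        obtain ⟨j', hj', rfl⟩ := hex q' hq'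
        rw [(hI j hj).2, (hI j' hj').2]
        by_contra! hlt
        have := jobRank_lt_jobRank hj' (⟨hlt.le, fun h => by linarith [h.1]⟩ :
          Precedes (σ.realArr 0) j' j)
        omega
  · simp only [RealExpr.cost, NatExpr.cost]
    ring_nf
    omega

/-! ### The candidate values -/

/-- Appends the utilities of job `nat 1` at the completion times `r i + k p + p`, for `i = nat 2` and
all `k`. -/
def candidateRow : Program :=
  .setReal 3 (.add (.cell 0 (.reg 2)) (.reg 0)) ;;
  forLoop 3 0 (.storeReal 2 (.reg 4) (.util (.reg 1) (.reg 3)) ;;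
    .setReal 3 (.add (.reg 3) (.reg 0)) ;; .setNat 4 (.add (.reg 4) (.const 1)))

/-- Lists the utilities of all jobs at all grid times in real array `2`, and their number in
`nat 4`. -/
def candidateProgram : Program :=
  .setNat 4 (.const 0) ;; forLoop 1 0 (forLoop 2 0 candidateRow)

theorem runs_candidateRow {N j i : ℕ} (hn : σ.nat 0 = n) (hN : σ.nat 4 = N) (hj : σ.nat 1 = j)
    (hi : σ.nat 2 = i) :
    Runs u candidateRow σ (n * 24 + 15) fun σ' => σ'.nat 4 = N + n ∧
      (∀ x < N, σ'.realArr 2 x = σ.realArr 2 x) ∧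
      ∀ k < n, ∃ x < N + n, σ'.realArr 2 x = u j (σ.realArr 0 i + (k : ℕ) * σ.real 0 + σ.real 0) := by
  unfold candidateRow
  apply Runs.mono
  · apply Runs.step
    apply Runs.setReal
    apply Runs.forLoop (N := n) (fun m σ' => σ'.nat 4 = N + m ∧
      σ'.real 3 = σ.realArr 0 i + (m : ℕ) * σ.real 0 + σ.real 0 ∧
      (∀ x < N, σ'.realArr 2 x = σ.realArr 2 x) ∧
      ∀ k < m, ∃ x < N + m, σ'.realArr 2 x = u j (σ.realArr 0 i + (k : ℕ) * σ.real 0 + σ.real 0))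
      rfl rfl (by decide)
    · exact hn
    · simp [RealExpr.eval, NatExpr.eval, hN, hi]
    · rintro m hm σ₁ f₁ hm₁ ⟨h1, h2, h3, h4⟩
      have e0 : σ₁.real 0 = σ.real 0 := f₁.real 0 rfl
      have e1 : σ₁.nat 1 = j := (f₁.nat 1 rfl).trans hj
      apply Runs.step
      apply Runs.storeReal
      apply Runs.step
      apply Runs.setReal
      apply Runs.setNat
      simp only [NatExpr.eval, RealExpr.eval, State.setNat_nat, State.setNat_real,
        State.setNat_realArr, State.setReal_nat, State.setReal_real, State.setReal_realArr,
        State.storeReal_nat, State.storeReal_real, State.storeReal_realArr, if_true, h1, h2, e0, e1]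
      refine ⟨by simp; omega, by push_cast; ring, fun x hx => ?_, fun k hk => ?_⟩
      · rw [Function.update_of_ne (by omega)]; exact h3 x hx
      · rcases Nat.lt_succ_iff_lt_or_eq.1 hk with h | rfl
        · obtain ⟨x, hx, hx'⟩ := h4 k h
          exact ⟨x, by omega, by rw [Function.update_of_ne (by omega)]; exact hx'⟩
        · exact ⟨N + k, by omega, by simp⟩
    · rintro σ' - ⟨h1, -, h3, h4⟩
      exact ⟨h1, h3, h4⟩
  · simp only [RealExpr.cost, NatExpr.cost]
    omega

theorem runs_candidateProgram (hn : σ.nat 0 = n) :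
    Runs u candidateProgram σ (n * (n * (n * 24 + 23) + 14) + 8) fun σ' => σ'.nat 4 = n ^ 3 ∧
      ∀ j < n, ∀ i < n, ∀ k < n, ∃ x < n ^ 3,
        σ'.realArr 2 x = u j (σ.realArr 0 i + (k : ℕ) * σ.real 0 + σ.real 0) := by
  unfold candidateProgram
  apply Runs.mono
  · apply Runs.step
    apply Runs.setNat
    apply Runs.forLoop (N := n) (fun m σ' => σ'.nat 4 = m * (n * n) ∧
      ∀ j < m, ∀ i < n, ∀ k < n, ∃ x < m * (n * n),
        σ'.realArr 2 x = u j (σ.realArr 0 i + (k : ℕ) * σ.real 0 + σ.real 0)) rfl rfl (by decide)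
    · exact hn
    · simp [NatExpr.eval]
    · rintro j hj σ₁ f₁ hj₁ ⟨h1, h2⟩
      apply Runs.forLoop (N := n) (fun m σ' => σ'.nat 4 = j * (n * n) + m * n ∧
        (∀ x < j * (n * n), σ'.realArr 2 x = σ₁.realArr 2 x) ∧
        ∀ i < m, ∀ k < n, ∃ x < j * (n * n) + m * n,
          σ'.realArr 2 x = u j (σ.realArr 0 i + (k : ℕ) * σ.real 0 + σ.real 0)) rfl rfl (by decide)
      · exact (f₁.nat 0 rfl).trans hn
      · simpa using h1
      · rintro i hi σ₂ f₂ hi₂ ⟨g1, g2, g3⟩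
        have en : σ₂.nat 0 = n := (f₂.nat 0 rfl).trans ((f₁.nat 0 rfl).trans hn)
        have ej : σ₂.nat 1 = j := (f₂.nat 1 rfl).trans hj₁
        have e0 : σ₂.real 0 = σ.real 0 := (f₂.real 0 rfl).trans (f₁.real 0 rfl)
        have er : σ₂.realArr 0 = σ.realArr 0 := (f₂.realArr 0 rfl).trans (f₁.realArr 0 rfl)
        have es : j * (n * n) + i * n + n = j * (n * n) + (i + 1) * n := by ring
        refine (runs_candidateRow en g1 ej hi₂).imp ?_
        rintro σ₃ - ⟨k1, k2, k3⟩
        rw [e0, er, es] at k3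
        rw [es] at k1
        refine ⟨k1, fun x hx => (k2 x (by omega)).trans (g2 x hx), fun i' hi' k hk => ?_⟩
        rcases Nat.lt_succ_iff_lt_or_eq.1 hi' with h | rfl
        · obtain ⟨x, hx, hx'⟩ := g3 i' h k hk
          exact ⟨x, by omega, (k2 x hx).trans hx'⟩
        · exact k3 k hk
      · rintro σ₂ - ⟨g1, g2, g3⟩
        have es : j * (n * n) + n * n = (j + 1) * (n * n) := by ring
        rw [es] at g1 g3
        refine ⟨g1, fun j' hj' i hi k hk => ?_⟩
        rcases Nat.lt_succ_iff_lt_or_eq.1 hj' with h | rfl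
        · obtain ⟨x, hx, hx'⟩ := h2 j' h i hi k hk
          refine ⟨x, by rw [← es]; omega, (g2 x hx).trans hx'⟩
        · exact g3 i hi k hk
    · rintro σ' - ⟨h1, h2⟩
      have es : n * (n * n) = n ^ 3 := by ring
      rw [es] at h1 h2
      exact ⟨h1, h2⟩
  · simp only [NatExpr.cost]
    ring_nf
    omega

end FairScheduling

namespace FairScheduling

open Program

/-! ### Merge sort -/

/-- The segment `[lo, k)` of `B` is the result of merging the segments `[lo, i)` and `[mid, j)` of
`A`, in the course of merging `[lo, mid)` and `[mid, hi)`. Of the correspondence of values, only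
this is recorded: no value of `A` gets lost. -/
structure IsMerge (A B : ℕ → ℝ) (lo mid hi i j k : ℕ) : Prop where
  lo_le : lo ≤ i
  le_mid : i ≤ mid
  mid_le : mid ≤ j
  le_hi : j ≤ hi
  sum : i + j = k + mid
  sorted : ∀ a b, lo ≤ a → a ≤ b → b < k → B a ≤ B b
  le_left : ∀ a x, lo ≤ a → a < k → i ≤ x → x < mid → B a ≤ A x
  le_right : ∀ a x, lo ≤ a → a < k → j ≤ x → x < hi → B a ≤ A x
  mem_left : ∀ x, lo ≤ x → x < i → ∃ y, lo ≤ y ∧ y < k ∧ B y = A x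
  mem_right : ∀ x, mid ≤ x → x < j → ∃ y, lo ≤ y ∧ y < k ∧ B y = A x

theorem IsMerge.push {A B : ℕ → ℝ} {lo mid hi i j k i' j' : ℕ} {v : ℝ}
    (h : IsMerge A B lo mid hi i j k) (hii : i ≤ i') (hjj : j ≤ j') (hi' : i' ≤ mid) (hj' : j' ≤ hi)
    (hsum : i' + j' = k + 1 + mid) (hB : ∀ a, lo ≤ a → a < k → B a ≤ v)
    (hl : ∀ x, i' ≤ x → x < mid → v ≤ A x) (hr : ∀ x, j' ≤ x → x < hi → v ≤ A x)
    (hvl : ∀ x, i ≤ x → x < i' → v = A x) (hvr : ∀ x, j ≤ x → x < j' → v = A x) :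
    IsMerge A (Function.update B k v) lo mid hi i' j' (k + 1) := by
  have hu : ∀ a, a < k → Function.update B k v a = B a := fun a ha => Function.update_of_ne ha.ne _ _
  have hk : lo ≤ k := by have := h.lo_le; have := h.mid_le; have := h.sum; omega
  have hmem : ∀ w, (∃ y, lo ≤ y ∧ y < k ∧ B y = w) →
      ∃ y, lo ≤ y ∧ y < k + 1 ∧ Function.update B k v y = w := by
    rintro w ⟨y, h1, h2, h3⟩
    exact ⟨y, h1, by omega, by rw [hu y h2, h3]⟩
  have hnew : ∀ w, v = w → ∃ y, lo ≤ y ∧ y < k + 1 ∧ Function.update B k v y = w :=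
    fun w hw => ⟨k, hk, by omega, by simpa using hw⟩
  refine ⟨h.lo_le.trans hii, hi', h.mid_le.trans hjj, hj', hsum, fun a b h1 h2 h3 => ?_,
    fun a x h1 h2 h3 h4 => ?_, fun a x h1 h2 h3 h4 => ?_, fun x h1 h2 => ?_, fun x h1 h2 => ?_⟩
  · rcases Nat.lt_succ_iff_lt_or_eq.1 h3 with h3 | rfl
    · rw [hu a (by omega), hu b h3]; exact h.sorted a b h1 h2 h3
    · rcases h2.lt_or_eq with h2 | rfl
      · rw [hu a h2, Function.update_self]; exact hB a h1 h2
      · exact le_rfl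
  · rcases Nat.lt_succ_iff_lt_or_eq.1 h2 with h2 | rfl
    · rw [hu a h2]; exact h.le_left a x h1 h2 (by omega) h4
    · rw [Function.update_self]; exact hl x h3 h4
  · rcases Nat.lt_succ_iff_lt_or_eq.1 h2 with h2 | rfl
    · rw [hu a h2]; exact h.le_right a x h1 h2 (by omega) h4
    · rw [Function.update_self]; exact hr x h3 h4
  · by_cases hx : x < i
    · exact hmem _ (h.mem_left x h1 hx)
    · exact hnew _ (hvl x (by omega) h2)
  · by_cases hx : x < j
    · exact hmem _ (h.mem_right x h1 hx)
    · exact hnew _ (hvr x (by omega) h2)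

/-- Moves the smaller one of `realArr 2 (nat 9)` and `realArr 2 (nat 10)` to `realArr 3 (nat 11)`,
where `nat 7` and `nat 8` are the ends of the two segments that are being merged. -/
def mergeStep : Program :=
  .ite (.and (.not (.natLe (.reg 7) (.reg 9)))
      (.not (.and (.not (.natLe (.reg 8) (.reg 10)))
        (.realLe (.cell 2 (.reg 10)) (.cell 2 (.reg 9))))))
    (.storeReal 3 (.reg 11) (.cell 2 (.reg 9)) ;; .setNat 9 (.add (.reg 9) (.const 1)))
    (.storeReal 3 (.reg 11) (.cell 2 (.reg 10)) ;; .setNat 10 (.add (.reg 10) (.const 1))) ;;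
  .setNat 11 (.add (.reg 11) (.const 1))

/-- Merges the segments of real array `2` from `nat 9` to `nat 7` and from `nat 10` to `nat 8` into real
array `3`, from `nat 11` on. -/
def mergeLoop : Program :=
  .while (.not (.natLe (.reg 8) (.reg 11))) mergeStep

/-- Merges the two segments of length `nat 5` of real array `2` that start at `nat 6` (cut off at
`nat 4`), and advances `nat 6` to the next pair of segments. -/
def mergeBlock : Program :=
  .setNat 7 (.sub (.reg 4) (.sub (.reg 4) (.add (.reg 6) (.reg 5)))) ;;
  .setNat 8 (.sub (.reg 4) (.sub (.reg 4) (.add (.reg 6) (.add (.reg 5) (.reg 5))))) ;;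
  .setNat 9 (.reg 6) ;; .setNat 10 (.reg 7) ;; .setNat 11 (.reg 6) ;;
  mergeLoop ;;
  .setNat 6 (.add (.reg 6) (.add (.reg 5) (.reg 5)))

/-- Merges the segments of length `nat 5` pairwise. -/
def mergePass : Program :=
  .setNat 6 (.const 0) ;;
  .while (.not (.natLe (.reg 4) (.reg 6))) mergeBlock ;;
  forLoop 1 4 (.storeReal 2 (.reg 1) (.cell 3 (.reg 1))) ;;
  .setNat 5 (.add (.reg 5) (.reg 5))

/-- Sorts the first `nat 4` entries of real array `2`. -/
def mergeSort : Program :=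
  .setNat 5 (.const 1) ;;
  .while (.not (.natLe (.reg 4) (.reg 5))) mergePass

variable {u : ℕ → ℝ → ℝ} {σ : State}

theorem runs_mergeLoop {lo mid hi : ℕ} (h7 : σ.nat 7 = mid) (h8 : σ.nat 8 = hi) (h9 : σ.nat 9 = lo)
    (h10 : σ.nat 10 = mid) (h11 : σ.nat 11 = lo) (hlm : lo ≤ mid) (hmh : mid ≤ hi)
    (hs : ∀ a b, lo ≤ a → a ≤ b → b < mid → σ.realArr 2 a ≤ σ.realArr 2 b)
    (hs' : ∀ a b, mid ≤ a → a ≤ b → b < hi → σ.realArr 2 a ≤ σ.realArr 2 b) :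
    Runs u mergeLoop σ ((hi - lo) * 50 + 10) fun σ' =>
      (∀ y < lo, σ'.realArr 3 y = σ.realArr 3 y) ∧
      (∀ a b, lo ≤ a → a ≤ b → b < hi → σ'.realArr 3 a ≤ σ'.realArr 3 b) ∧
      ∀ x, lo ≤ x → x < hi → ∃ y, lo ≤ y ∧ y < hi ∧ σ'.realArr 3 y = σ.realArr 2 x := by
  unfold mergeLoop
  refine Runs.whileLoop (fun m σ' => ∃ i j k, σ'.nat 9 = i ∧ σ'.nat 10 = j ∧ σ'.nat 11 = k ∧
    IsMerge (σ.realArr 2) (σ'.realArr 3) lo mid hi i j k ∧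
    (∀ y < lo, σ'.realArr 3 y = σ.realArr 3 y) ∧ m = (hi - k) * 50 + 10) ?_ ?_ ?_
  · refine ⟨lo, mid, lo, h9, h10, h11, ⟨le_rfl, hlm, le_rfl, hmh, by omega, ?_, ?_, ?_, ?_, ?_⟩,
      fun _ _ => rfl, rfl⟩ <;> (intros; omega)
  · rintro m σ₁ f₁ ⟨i, j, k, e9, e10, e11, hM, hlo, rfl⟩ hb
    have e7 : σ₁.nat 7 = mid := (f₁.nat 7 rfl).trans h7
    have e8 : σ₁.nat 8 = hi := (f₁.nat 8 rfl).trans h8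
    have e2 : σ₁.realArr 2 = σ.realArr 2 := f₁.realArr 2 rfl
    have hk : k < hi := by simpa [BoolExpr.Holds, NatExpr.eval, e8, e11] using hb
    obtain ⟨hM1, hM2, hM3, hM4, hM5⟩ :=
      (⟨hM.lo_le, hM.le_mid, hM.mid_le, hM.le_hi, hM.sum⟩ :
        lo ≤ i ∧ i ≤ mid ∧ mid ≤ j ∧ j ≤ hi ∧ i + j = k + mid)
    have hlo' : ∀ v, ∀ y < lo, Function.update (σ₁.realArr 3) k v y = σ.realArr 3 y := fun v y hy => by
      rw [Function.update_of_ne (by omega)]; exact hlo y hy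
    refine ⟨46, (hi - (k + 1)) * 50 + 10, ?_, ?_⟩
    · simp only [BoolExpr.cost, NatExpr.cost]; omega
    unfold mergeStep
    apply Runs.mono
    · apply Runs.step
      apply Runs.ite
      · intro hc
        simp [BoolExpr.Holds, RealExpr.eval, NatExpr.eval, e7, e8, e9, e10, e2] at hc
        apply Runs.step
        apply Runs.storeReal
        apply Runs.setNat
        apply Runs.setNat
        refine ⟨i + 1, j, k + 1, by simp [NatExpr.eval, e9], by simp [e10],
          by simp [NatExpr.eval, e11], ?_, ?_, rfl⟩
        · simp [NatExpr.eval, RealExpr.eval, e11, e9, e2]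
          refine hM.push (by omega) le_rfl (by omega) hM4 (by omega)
            (fun a h1 h2 => hM.le_left a i h1 h2 le_rfl hc.1)
            (fun x h1 h2 => hs i x (by omega) (by omega) h2)
            (fun x h1 h2 => (hc.2 (by omega)).le.trans (hs' j x hM3 h1 h2))
            (fun x h1 h2 => by rw [show x = i by omega]) (fun x h1 h2 => by omega)
        · simpa [NatExpr.eval, RealExpr.eval, e11] using hlo' _
      · intro hc
        simp [BoolExpr.Holds, RealExpr.eval, NatExpr.eval, e7, e8, e9, e10, e2] at hc
        have hj : j < hi := by
          by_cases h : i < mid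
          · exact (hc h).1
          · omega
        apply Runs.step
        apply Runs.storeReal
        apply Runs.setNat
        apply Runs.setNat
        refine ⟨i, j + 1, k + 1, by simp [e9], by simp [NatExpr.eval, e10],
          by simp [NatExpr.eval, e11], ?_, ?_, rfl⟩
        · simp [NatExpr.eval, RealExpr.eval, e11, e10, e2]
          refine hM.push le_rfl (by omega) hM2 (by omega) (by omega)
            (fun a h1 h2 => hM.le_right a j h1 h2 le_rfl hj)
            (fun x h1 h2 => (hc (by omega)).2.trans (hs i x hM1 h1 h2))
            (fun x h1 h2 => hs' j x hM3 (by omega) h2)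
            (fun x h1 h2 => by omega) (fun x h1 h2 => by rw [show x = j by omega])
        · simpa [NatExpr.eval, RealExpr.eval, e11] using hlo' _
    · simp only [BoolExpr.cost, NatExpr.cost, RealExpr.cost]; omega
  · rintro m σ₁ f₁ ⟨i, j, k, e9, e10, e11, hM, hlo, rfl⟩ hb
    have e8 : σ₁.nat 8 = hi := (f₁.nat 8 rfl).trans h8
    have hk : hi ≤ k := by simpa [BoolExpr.Holds, NatExpr.eval, e8, e11] using hb
    obtain ⟨hM1, hM2, hM3, hM4, hM5⟩ :=
      (⟨hM.lo_le, hM.le_mid, hM.mid_le, hM.le_hi, hM.sum⟩ :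
        lo ≤ i ∧ i ≤ mid ∧ mid ≤ j ∧ j ≤ hi ∧ i + j = k + mid)
    obtain rfl : k = hi := by omega
    obtain rfl : i = mid := by omega
    refine ⟨by simp [BoolExpr.cost, NatExpr.cost], hlo, hM.sorted, fun x h1 h2 => ?_⟩
    by_cases h : x < i
    · exact hM.mem_left x h1 h
    · exact hM.mem_right x (by omega) (by omega)

/-- The segments `[t w, (t + 1) w)`, cut off at `N`, are sorted, for `t < m`. -/
def SortedBlocks (A : ℕ → ℝ) (N w m : ℕ) : Prop :=
  ∀ t < m, ∀ a b, t * w ≤ a → a ≤ b → b < (t + 1) * w → b < N → A a ≤ A b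

theorem runs_mergeBlock {N w t : ℕ} (h4 : σ.nat 4 = N) (h5 : σ.nat 5 = w)
    (h6 : σ.nat 6 = t * (w + w)) (hlt : t * (w + w) < N)
    (hA : ∀ m, SortedBlocks (σ.realArr 2) N w m)
    (hB : SortedBlocks (σ.realArr 3) N (w + w) t)
    (hmem : ∀ x < t * (w + w), ∃ y < t * (w + w), σ.realArr 3 y = σ.realArr 2 x) :
    Runs u mergeBlock σ ((min N ((t + 1) * (w + w)) - t * (w + w)) * 50 + 50) fun σ' =>
      σ'.nat 6 = (t + 1) * (w + w) ∧ SortedBlocks (σ'.realArr 3) N (w + w) (t + 1) ∧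
      ∀ x < N, x < (t + 1) * (w + w) →
        ∃ y < N, y < (t + 1) * (w + w) ∧ σ'.realArr 3 y = σ.realArr 2 x := by
  have hmin : ∀ a, N - (N - a) = min N a := fun a => by omega
  have e1 : t * (w + w) + w = (2 * t + 1) * w := by ring
  have e2 : t * (w + w) + (w + w) = (t + 1) * (w + w) := by ring
  have e3 : t * (w + w) = 2 * t * w := by ring
  have e4 : (t + 1) * (w + w) = (2 * t + 1 + 1) * w := by ring
  have hnext : t * (w + w) + w ≤ (t + 1) * (w + w) := by rw [← e2]; omega
  unfold mergeBlock
  apply Runs.mono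
  · apply Runs.step
    apply Runs.setNat
    apply Runs.step
    apply Runs.setNat
    apply Runs.step
    apply Runs.setNat
    apply Runs.step
    apply Runs.setNat
    apply Runs.step
    apply Runs.setNat
    apply Runs.seq
    · apply runs_mergeLoop (lo := t * (w + w)) (mid := min N (t * (w + w) + w))
        (hi := min N ((t + 1) * (w + w)))
      · simp [NatExpr.eval, h4, h5, h6, hmin]
      · simp [NatExpr.eval, h4, h5, h6, hmin, e2]
      · simp [NatExpr.eval, h6]
      · simp [NatExpr.eval, h4, h5, h6, hmin]
      · simp [NatExpr.eval, h6]
      · omega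
      · omega
      · intro a b ha hab hb
        exact hA (2 * t + 1) (2 * t) (by omega) a b (by omega) hab (by rw [← e1]; omega) (by omega)
      · intro a b ha hab hb
        by_cases hbN : t * (w + w) + w ≤ a
        · exact hA (2 * t + 2) (2 * t + 1) (by omega) a b (by omega) hab (by omega) (by omega)
        · omega
    rintro σ₁ f₁ ⟨g1, g2, g3⟩
    apply Runs.setNat
    have k6 : σ₁.nat 6 = t * (w + w) := by rw [f₁.nat 6 rfl]; simpa using h6
    have k5 : σ₁.nat 5 = w := by rw [f₁.nat 5 rfl]; simpa using h5
    simp only [State.setNat_realArr] at g1 g2 g3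
    refine ⟨by simp [NatExpr.eval, k6, k5, e2], fun s hs a b h1 h2 h3 h4 => ?_, fun x hx hx' => ?_⟩
    · simp only [State.setNat_realArr]
      rcases Nat.lt_succ_iff_lt_or_eq.1 hs with hs | rfl
      · have : (s + 1) * (w + w) ≤ t * (w + w) := Nat.mul_le_mul_right _ hs
        rw [g1 a (by omega), g1 b (by omega)]
        exact hB s hs a b h1 h2 h3 h4
      · exact g2 a b h1 h2 (by omega)
    · simp only [State.setNat_realArr]
      by_cases h : x < t * (w + w)
      · obtain ⟨y, hy, hy'⟩ := hmem x h
        exact ⟨y, by omega, by omega, (g1 y hy).trans hy'⟩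
      · obtain ⟨y, hy1, hy2, hy⟩ := g3 x (by omega) (by omega)
        exact ⟨y, by omega, by omega, hy⟩
  · simp only [NatExpr.cost]
    omega

theorem runs_mergePass {N w : ℕ} (h4 : σ.nat 4 = N) (h5 : σ.nat 5 = w) (hw : 0 < w)
    (hA : ∀ m, SortedBlocks (σ.realArr 2) N w m) :
    Runs u mergePass σ (N * 120 + 20) fun σ' =>
      σ'.nat 5 = w + w ∧ (∀ m, SortedBlocks (σ'.realArr 2) N (w + w) m) ∧
      ∀ x < N, ∃ y < N, σ'.realArr 2 y = σ.realArr 2 x := by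
  unfold mergePass
  apply Runs.mono
  · apply Runs.step
    apply Runs.setNat
    apply Runs.seq (T := N * 104 + 4) (Q' := fun σ' =>
      (∀ m, SortedBlocks (σ'.realArr 3) N (w + w) m) ∧
      ∀ x < N, ∃ y < N, σ'.realArr 3 y = σ.realArr 2 x)
    · apply Runs.whileLoop (fun m σ' => ∃ t, σ'.nat 6 = t * (w + w) ∧
        SortedBlocks (σ'.realArr 3) N (w + w) t ∧
        (∀ x < N, x < t * (w + w) → ∃ y < N, y < t * (w + w) ∧ σ'.realArr 3 y = σ.realArr 2 x) ∧
        m = (N - t * (w + w)) * 104 + 4)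
      · exact ⟨0, by simp [NatExpr.eval], fun t ht => by omega, fun x _ hx => by omega, by simp⟩
      · rintro m σ₁ f₁ ⟨t, h6, hB, hmem, rfl⟩ hb
        have e4 : σ₁.nat 4 = N := (f₁.nat 4 rfl).trans h4
        have e5 : σ₁.nat 5 = w := (f₁.nat 5 rfl).trans h5
        have e2 : σ₁.realArr 2 = σ.realArr 2 := f₁.realArr 2 rfl
        have hlt : t * (w + w) < N := by
          simpa [BoolExpr.Holds, NatExpr.eval, e4, h6] using hb
        have hnext : (t + 1) * (w + w) = t * (w + w) + (w + w) := by ring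
        refine ⟨_, (N - (t + 1) * (w + w)) * 104 + 4, ?_,
          (runs_mergeBlock e4 e5 h6 hlt (by rwa [e2]) hB fun x hx => ?_).imp ?_⟩
        · simp only [BoolExpr.cost, NatExpr.cost]
          omega
        · obtain ⟨y, -, hy, hy'⟩ := hmem x (by omega) hx
          exact ⟨y, hy, by rw [e2]; exact hy'⟩
        · rintro σ₂ - ⟨g1, g2, g3⟩
          rw [e2] at g3
          exact ⟨t + 1, g1, g2, g3, rfl⟩
      · rintro m σ₁ f₁ ⟨t, h6, hB, hmem, rfl⟩ hb
        have e4 : σ₁.nat 4 = N := (f₁.nat 4 rfl).trans h4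
        have hle : N ≤ t * (w + w) := by
          simpa [BoolExpr.Holds, NatExpr.eval, e4, h6] using hb
        refine ⟨by simp [BoolExpr.cost, NatExpr.cost], fun m s hs a b h1 h2 h3 hbN => ?_,
          fun x hx => ?_⟩
        · refine hB s ?_ a b h1 h2 h3 hbN
          by_contra! hst
          have := Nat.mul_le_mul_right (w + w) hst
          omega
        · obtain ⟨y, hy, -, hy'⟩ := hmem x hx (by omega)
          exact ⟨y, hy, hy'⟩
    rintro σ₁ f₁ ⟨hB, hmem⟩
    have e4 : σ₁.nat 4 = N := (f₁.nat 4 rfl).trans h4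
    have e5 : σ₁.nat 5 = w := (f₁.nat 5 rfl).trans h5
    apply Runs.seq (Q' := fun σ' => ∀ x < N, σ'.realArr 2 x = σ₁.realArr 3 x)
    · apply Runs.forLoop (N := N) (fun m σ' => ∀ x < m, σ'.realArr 2 x = σ₁.realArr 3 x)
        rfl rfl (by decide) e4
      · intro x hx; omega
      · intro k hk σ₂ f₂ hk₂ hI
        have e3 : σ₂.realArr 3 = σ₁.realArr 3 := f₂.realArr 3 rfl
        apply Runs.storeReal
        intro x hx
        rcases Nat.lt_succ_iff_lt_or_eq.1 hx with h | rfl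
        · simpa [NatExpr.eval, hk₂, Function.update_of_ne h.ne] using hI x h
        · simp [NatExpr.eval, RealExpr.eval, hk₂, e3]
      · exact fun σ' _ h => h
    intro σ₂ f₂ h₂
    apply Runs.setNat
    have e5' : σ₂.nat 5 = w := (f₂.nat 5 rfl).trans e5
    refine ⟨by simp [NatExpr.eval, e5'], fun m t ht a b h1 h2 h3 h4 => ?_, fun x hx => ?_⟩
    · simp only [State.setNat_realArr]
      rw [h₂ a (by omega), h₂ b h4]
      exact hB m t ht a b h1 h2 h3 h4
    · obtain ⟨y, hy, hy'⟩ := hmem x hx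
      exact ⟨y, hy, (h₂ y hy).trans hy'⟩
  · simp only [NatExpr.cost, RealExpr.cost]
    omega

theorem runs_mergeSort {N : ℕ} (h4 : σ.nat 4 = N) :
    Runs u mergeSort σ (Nat.clog 2 N * (N * 120 + 24) + 6) fun σ' =>
      (∀ a b, a ≤ b → b < N → σ'.realArr 2 a ≤ σ'.realArr 2 b) ∧
      ∀ x < N, ∃ y < N, σ'.realArr 2 y = σ.realArr 2 x := by
  unfold mergeSort
  apply Runs.mono
  · apply Runs.step
    apply Runs.setNat
    apply Runs.whileLoop (m := Nat.clog 2 N * (N * 120 + 24) + 4) (fun m σ' => ∃ e,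
      σ'.nat 5 = 2 ^ e ∧ (∀ m, SortedBlocks (σ'.realArr 2) N (2 ^ e) m) ∧
      (∀ x < N, ∃ y < N, σ'.realArr 2 y = σ.realArr 2 x) ∧
      m = (Nat.clog 2 N - e) * (N * 120 + 24) + 4)
    · refine ⟨0, by simp [NatExpr.eval], fun m t ht a b h1 h2 h3 _ => ?_, fun x hx => ⟨x, hx, rfl⟩,
        by simp⟩
      obtain rfl : a = b := by omega
      exact le_rfl
    · rintro m σ₁ f₁ ⟨e, h5, hs, hmem, rfl⟩ hb
      have e4 : σ₁.nat 4 = N := (f₁.nat 4 rfl).trans h4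
      have hlt : 2 ^ e < N := by
        simpa [BoolExpr.Holds, NatExpr.eval, e4, h5] using hb
      have hclog : e < Nat.clog 2 N := (Nat.lt_clog_iff_pow_lt one_lt_two).2 hlt
      have hpow : 2 ^ e + 2 ^ e = 2 ^ (e + 1) := by ring
      refine ⟨_, (Nat.clog 2 N - (e + 1)) * (N * 120 + 24) + 4, ?_,
        (runs_mergePass e4 h5 (by positivity) hs).imp ?_⟩
      · obtain ⟨d, hd⟩ : ∃ d, Nat.clog 2 N = e + 1 + d := ⟨_, (Nat.add_sub_of_le hclog).symm⟩
        have h1 : e + 1 + d - e = d + 1 := by omega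
        have h2 : e + 1 + d - (e + 1) = d := by omega
        rw [hd, h1, h2, Nat.add_mul]
        simp only [BoolExpr.cost, NatExpr.cost]
        omega
      · rintro σ₂ - ⟨g1, g2, g3⟩
        rw [hpow] at g1 g2
        refine ⟨e + 1, g1, g2, fun x hx => ?_, rfl⟩
        obtain ⟨y, hy, hy'⟩ := hmem x hx
        obtain ⟨z, hz, hz'⟩ := g3 y hy
        exact ⟨z, hz, hz'.trans hy'⟩
    · rintro m σ₁ f₁ ⟨e, h5, hs, hmem, rfl⟩ hb
      have e4 : σ₁.nat 4 = N := (f₁.nat 4 rfl).trans h4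
      have hle : N ≤ 2 ^ e := by
        simpa [BoolExpr.Holds, NatExpr.eval, e4, h5] using hb
      refine ⟨by simp [BoolExpr.cost, NatExpr.cost], fun a b h1 h2 => ?_, hmem⟩
      exact hs 1 0 one_pos a b (by omega) h1 (by omega) h2
  · simp only [NatExpr.cost]
    omega

end FairScheduling

namespace FairScheduling

open Program

/-! ### Binary search among the candidate values -/

/-- Tests the middle value between the positions `nat 12` (attainable) and `nat 13` (not
attainable). -/
def searchStep : Program :=
  .setNat 14 (.half (.add (.reg 12) (.reg 13))) ;;
  .setReal 4 (.cell 2 (.reg 14)) ;;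
  decideProgram ;;
  .ite (.natLe (.const 1) (.reg 15)) (.setNat 12 (.reg 14)) (.setNat 13 (.reg 14))

/-- Finds the largest attainable one of the first `nat 4` entries of the sorted real array `2`, and a
schedule that attains it. -/
def searchProgram : Program :=
  .setNat 12 (.const 0) ;; .setNat 13 (.reg 4) ;;
  .while (.not (.natLe (.reg 13) (.add (.reg 12) (.const 1)))) searchStep ;;
  .setReal 4 (.cell 2 (.reg 12)) ;;
  decideProgram

/-- Computes a fair schedule. -/
def fairProgram : Program :=
  sortJobsProgram ;; candidateProgram ;; mergeSort ;; searchProgram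

variable {n : ℕ} {I : Problem n} {σ : State}

/-- Halving an interval (rounding up) pays for one iteration of cost `K`. -/
theorem clog_two_le_of_le_half {g g' K m : ℕ} (hg : 2 ≤ g) (hg' : g' ≤ (g + 1) / 2)
    (hm : Nat.clog 2 g * K ≤ m) : Nat.clog 2 g' * K + K ≤ m := by
  rw [Nat.clog_of_two_le one_lt_two hg, Nat.add_mul, one_mul] at hm
  refine le_trans ?_ hm
  have : Nat.clog 2 g' ≤ Nat.clog 2 ((g + 2 - 1) / 2) := Nat.clog_mono_right _ (by omega)
  gcongr

theorem runs_searchProgram {N : ℕ} (hn : 0 < n) (h : Prepared I σ) (h4 : σ.nat 4 = N) (hN : 0 < N)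
    (hsort : ∀ a b, a ≤ b → b < N → σ.realArr 2 a ≤ σ.realArr 2 b)
    (hmem : ∀ s ∈ I.schedules, ∃ x < N, σ.realArr 2 x = I.uMin s) (hne : I.schedules.Nonempty) :
    Runs I.utility searchProgram σ (Nat.clog 2 N * (500 * n ^ 3 + 30) + 500 * n ^ 3 + 20) fun σ' =>
      I.IsFair (σ'.output n) := by
  unfold searchProgram
  apply Runs.mono
  · apply Runs.step
    apply Runs.setNat
    apply Runs.step
    apply Runs.setNat
    apply Runs.seq (T := Nat.clog 2 N * (500 * n ^ 3 + 30) + 6) (Q' := fun σ' =>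
      ∃ lo, σ'.nat 12 = lo ∧ lo < N ∧ I.Attainable (σ.realArr 2 lo) ∧
        (lo + 1 < N → ¬ I.Attainable (σ.realArr 2 (lo + 1))))
    · apply Runs.whileLoop (fun m σ' => ∃ lo hi, σ'.nat 12 = lo ∧ σ'.nat 13 = hi ∧ lo < hi ∧ hi ≤ N ∧
        I.Attainable (σ.realArr 2 lo) ∧ (hi < N → ¬ I.Attainable (σ.realArr 2 hi)) ∧
        Nat.clog 2 (hi - lo) * (500 * n ^ 3 + 30) + 6 ≤ m)
      · obtain ⟨s, hs⟩ := hne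
        obtain ⟨x, hx, hxs⟩ := hmem s hs
        exact ⟨0, N, by simp [NatExpr.eval], by simp [NatExpr.eval, h4], hN, le_rfl,
          ⟨s, hs, hxs ▸ hsort 0 x (Nat.zero_le _) hx⟩, fun h => absurd h (lt_irrefl _), by simp⟩
      · rintro m σ₁ f₁ ⟨lo, hi, e12, e13, hlt, hhi, hA, hnA, hm⟩ hb
        have hP : Prepared I σ₁ := by
          refine Prepared.frame ?_ f₁ rfl rfl rfl rfl rfl
          exact ⟨h.nat_zero, h.real_zero, h.release, h.order_lt, h.order_inj, h.sorted_eq,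
            h.antitone⟩
        have ea : σ₁.realArr 2 = σ.realArr 2 := f₁.realArr 2 rfl
        have hgap : lo + 1 < hi := by
          simpa [BoolExpr.Holds, NatExpr.eval, e12, e13] using hb
        obtain ⟨m, rfl⟩ : ∃ a, m = a + 6 := ⟨m - 6, by omega⟩
        have hhalf := fun g' hg' => clog_two_le_of_le_half (g := hi - lo) (g' := g') (by omega) hg'
          (show Nat.clog 2 (hi - lo) * (500 * n ^ 3 + 30) ≤ m by omega)
        refine ⟨500 * n ^ 3 + 20, m + 6 - (500 * n ^ 3 + 30), ?_, ?_⟩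
        · have := hhalf 0 (Nat.zero_le _)
          simp only [BoolExpr.cost, NatExpr.cost]
          omega
        unfold searchStep
        apply Runs.mono
        · apply Runs.step
          apply Runs.setNat
          apply Runs.step
          apply Runs.setReal
          apply Runs.seq
          · apply runs_decideProgram (I := I) hn
            exact ⟨hP.nat_zero, hP.real_zero, hP.release, hP.order_lt, hP.order_inj, hP.sorted_eq,
              hP.antitone⟩
          rintro σ₂ f₂ ⟨hdec, -⟩
          simp [RealExpr.eval, NatExpr.eval, e12, e13, ea] at hdec
          have k12 : σ₂.nat 12 = lo := by rw [f₂.nat 12 rfl]; simpa using e12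
          have k13 : σ₂.nat 13 = hi := by rw [f₂.nat 13 rfl]; simpa using e13
          have k14 : σ₂.nat 14 = (lo + hi) / 2 := by
            rw [f₂.nat 14 rfl]; simp [NatExpr.eval, e12, e13]
          apply Runs.ite
          · intro hc
            simp only [BoolExpr.Holds, NatExpr.eval, hdec] at hc
            apply Runs.setNat
            have := hhalf (hi - (lo + hi) / 2) (by omega)
            exact ⟨(lo + hi) / 2, hi, by simp [NatExpr.eval, k14], by simpa using k13, by omega, hhi,
              hc, hnA, by omega⟩
          · intro hc
            simp only [BoolExpr.Holds, NatExpr.eval, hdec] at hc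
            apply Runs.setNat
            have := hhalf ((lo + hi) / 2 - lo) (by omega)
            exact ⟨lo, (lo + hi) / 2, by simpa using k12, by simp [NatExpr.eval, k14], by omega,
              by omega, hA, fun _ => hc, by omega⟩
        · simp only [BoolExpr.cost, NatExpr.cost, RealExpr.cost]
          omega
      · rintro m σ₁ f₁ ⟨lo, hi, e12, e13, hlt, hhi, hA, hnA, hm⟩ hb
        have hgap : hi ≤ lo + 1 := by
          simpa [BoolExpr.Holds, NatExpr.eval, e12, e13] using hb
        obtain rfl : hi = lo + 1 := by omega
        refine ⟨?_, lo, e12, by omega, hA, hnA⟩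
        simp only [BoolExpr.cost, NatExpr.cost]
        omega
    rintro σ₁ f₁ ⟨lo, e12, hlo, hA, hnA⟩
    have hP : Prepared I σ₁ := by
      refine Prepared.frame ?_ f₁ rfl rfl rfl rfl rfl
      exact ⟨h.nat_zero, h.real_zero, h.release, h.order_lt, h.order_inj, h.sorted_eq, h.antitone⟩
    have ea : σ₁.realArr 2 = σ.realArr 2 := f₁.realArr 2 rfl
    apply Runs.step
    apply Runs.setReal
    refine (runs_decideProgram (I := I) hn ?_).imp ?_
    · exact ⟨hP.nat_zero, hP.real_zero, hP.release, hP.order_lt, hP.order_inj, hP.sorted_eq,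
        hP.antitone⟩
    · rintro σ₂ - ⟨hdec, hout⟩
      simp [RealExpr.eval, NatExpr.eval, e12, ea] at hdec hout
      obtain ⟨hs, hv⟩ := hout (hdec.2 hA)
      refine ⟨hs, fun s' hs' => ?_⟩
      obtain ⟨x, hx, hxs⟩ := hmem s' hs'
      -- a better schedule would make the next larger candidate attainable
      by_contra! hlt
      have hxlo : lo < x := by
        by_contra! hle
        have := hsort x lo hle hlo
        linarith
      exact hnA (by omega) ⟨s', hs', hxs ▸ hsort (lo + 1) x hxlo hx⟩
  · simp only [NatExpr.cost, RealExpr.cost]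
    omega

theorem runs_fairProgram (hn : 0 < n) (hne : I.schedules.Nonempty) (LB UB : ℝ) :
    Runs I.utility fairProgram (I.input LB UB) (1500 * n ^ 3 * (Nat.clog 2 (n ^ 3) + 1)) fun σ' =>
      I.IsFair (σ'.output n) := by
  unfold fairProgram
  apply Runs.mono
  · apply Runs.seq
    · apply runs_sortJobsProgram (I := I)
      · simp [Problem.input]
      · simp [Problem.input]
      · intro i hi
        simp [Problem.input, hi]
    intro σ₁ f₁ hP₁
    apply Runs.seq
    · exact runs_candidateProgram hP₁.nat_zero
    rintro σ₂ f₂ ⟨hN, hcand⟩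
    have hP₂ : Prepared I σ₂ := hP₁.frame f₂ rfl rfl rfl rfl rfl
    apply Runs.seq
    · exact runs_mergeSort hN
    rintro σ₃ f₃ ⟨hsort, hmem⟩
    have hP₃ : Prepared I σ₃ := hP₂.frame f₃ rfl rfl rfl rfl rfl
    have h4 : σ₃.nat 4 = n ^ 3 := (f₃.nat 4 rfl).trans hN
    refine runs_searchProgram hn hP₃ h4 (by positivity) hsort (fun s hs => ?_) hne
    obtain ⟨j, hj⟩ := I.exists_uMin_eq hn s
    obtain ⟨i, k, hk, hik⟩ := Problem.exists_start_eq hs j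
    obtain ⟨x, hx, hxu⟩ := hcand j j.2 i i.2 k hk
    obtain ⟨y, hy, hyx⟩ := hmem x hx
    refine ⟨y, hy, ?_⟩
    rw [hyx, hxu, hj, hik, hP₁.release i i.2, hP₁.real_zero, I.utility_of_lt j.2]
  · have h1 : n ≤ n ^ 3 := Nat.le_self_pow (by norm_num) n
    have h2 : n ^ 2 ≤ n ^ 3 := Nat.pow_le_pow_right hn (by norm_num)
    have h3 : 1 ≤ n ^ 3 := Nat.one_le_pow _ _ hn
    have h4 : Nat.clog 2 (n ^ 3) ≤ Nat.clog 2 (n ^ 3) * n ^ 3 := Nat.le_mul_of_pos_right _ h3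
    generalize Nat.clog 2 (n ^ 3) = K at *
    ring_nf at *
    omega

theorem clog_two_pow_three_add_one_mul_log_le (hn : 0 < n) :
    ((Nat.clog 2 (n ^ 3) + 1 : ℕ) : ℝ) * Real.log 2 ≤ 7 * Real.log (n + 1) := by
  have h1 : Nat.clog 2 (n ^ 3) ≤ (Nat.log 2 n + 1) * 3 := by
    refine Nat.clog_le_of_le_pow ?_
    rw [pow_mul]
    exact Nat.pow_le_pow_left (Nat.lt_pow_succ_log_self one_lt_two n).le 3
  have hn' : (1 : ℝ) ≤ n := by exact_mod_cast hn
  have h2 : (Nat.log 2 n : ℝ) * Real.log 2 ≤ Real.log (n + 1) := by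
    rw [← Real.log_pow]
    refine Real.log_le_log (by positivity) ?_
    have : 2 ^ Nat.log 2 n ≤ n := Nat.pow_log_le_self 2 hn.ne'
    have h : ((2 ^ Nat.log 2 n : ℕ) : ℝ) ≤ n := by exact_mod_cast this
    push_cast at h
    linarith
  have h3 : Real.log 2 ≤ Real.log (n + 1) := Real.log_le_log (by norm_num) (by linarith)
  have h4 : ((Nat.clog 2 (n ^ 3) + 1 : ℕ) : ℝ) ≤ 3 * Nat.log 2 n + 4 := by
    exact_mod_cast (by omega : Nat.clog 2 (n ^ 3) + 1 ≤ 3 * Nat.log 2 n + 4)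
  have h5 : 0 ≤ Real.log 2 := Real.log_nonneg (by norm_num)
  nlinarith [mul_le_mul_of_nonneg_right h4 h5]

end FairScheduling

theorem mainTheorem10 :
    ∃ (P : FairScheduling.Program) (c : ℝ),
      ∀ (n : ℕ) (_ : 0 < n) (I : FairScheduling.Problem n) (LB UB : ℝ)
        (_ : ∃ s ∈ I.schedules, LB ≤ I.uMin s)
        (_ : ∀ s ∈ I.schedules, I.uMin s ≤ UB),
        ∃ (T : ℕ) (σ : FairScheduling.State),
          FairScheduling.Exec I.utility P (I.input LB UB) T σ ∧
          I.IsFair (σ.output n) ∧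
          (T : ℝ) ≤ c * (n : ℝ) ^ 3 * Real.log (n + 1) * Real.log (UB - LB + 2) := by
  have hlog : 0 < Real.log 2 := Real.log_pos (by norm_num)
  refine ⟨FairScheduling.fairProgram, 10500 / Real.log 2 ^ 2, fun n hn I LB UB hLB hUB => ?_⟩
  obtain ⟨s, hs, hsLB⟩ := hLB
  obtain ⟨T, σ, hT, hex, hfair⟩ := FairScheduling.runs_fairProgram hn ⟨s, hs⟩ LB UB
  refine ⟨T, σ, hex, hfair, ?_⟩
  have h1 := FairScheduling.clog_two_pow_three_add_one_mul_log_le hn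
  have h2 : Real.log 2 ≤ Real.log (UB - LB + 2) :=
    Real.log_le_log (by norm_num) (by linarith [hUB s hs])
  have h3 : 0 ≤ Real.log (n + 1) := Real.log_nonneg (by linarith [(Nat.cast_nonneg n : (0 : ℝ) ≤ n)])
  have h4 : (T : ℝ) ≤ 1500 * (n : ℝ) ^ 3 * ((Nat.clog 2 (n ^ 3) + 1 : ℕ) : ℝ) := by exact_mod_cast hT
  calc (T : ℝ) ≤ 1500 * (n : ℝ) ^ 3 * ((Nat.clog 2 (n ^ 3) + 1 : ℕ) : ℝ) := h4
    _ = 1500 * (n : ℝ) ^ 3 * (((Nat.clog 2 (n ^ 3) + 1 : ℕ) : ℝ) * Real.log 2) / Real.log 2 := by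
      field_simp
    _ ≤ 1500 * (n : ℝ) ^ 3 * (7 * Real.log (n + 1)) / Real.log 2 := by gcongr
    _ = 10500 / Real.log 2 ^ 2 * (n : ℝ) ^ 3 * Real.log (n + 1) * Real.log 2 := by
      field_simp; ring
    _ ≤ 10500 / Real.log 2 ^ 2 * (n : ℝ) ^ 3 * Real.log (n + 1) * Real.log (UB - LB + 2) := by
      gcongr
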